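/- **Precedence constrained set cover (PCSC).** An instance consists of a universe of $n$ items, an indexed family of $m$ subsets of the universe (repetitions allowed), a partial order $\preceq$ on the family, and a rational number $0<f\le 1$. A solution is a subfamily $\mathcal C$ that is precedence-closed (if $A\in\mathcal C$ and $B\preceq A$ then $B\in\mathcal C$) and whose members together cover at least $f\cdot n$ items; the goal is to minimize $|\mathcal C|$. A polynomial-time $\rho$-approximation algorithm is a probabilistic polynomial-time algorithm that, on every instance that has a solution, outputs with probability at least $2/3$ a solution whose size is at most $\rho$ times the minimum. (Deterministic algorithms are a special case.) **Planted Dense Subgraph (PDS) conjecture.** Let $0<\beta<\alpha<1$ be constants and $k=\lfloor\sqrt N\rfloor$. There are no probabilistic polynomial-time algorithm and no constant $\delta>0$ such that, for all sufficiently large $N$, the algorithm identifies with probability at least $\frac12+\delta$ from which of the following two distributions its input graph on $N$ vertices was drawn, each being used with probability $\frac12$: * the Erdős–Rényi graph $G(N,N^{\alpha-1})$; * the Erdős–Rényi graph $G(N,N^{\alpha-1})$ with a planted subgraph of size $k$ and edge density $k^{\beta-1}$: a set $S$ of $k$ vertices is chosen uniformly at random, and independently each pair of vertices inside $S$ is an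 edge with probability $k^{\beta-1}$ and every other pair with probability $N^{\alpha-1}$. **Theorem.** Assume the PDS conjecture. Then for every $\epsilon>0$: 1. there is no function $\rho(m)=O(m^{1/12-\epsilon})$ for which PCSC has a polynomial-time $\rho(m)$-approximation algorithm; 2. there is no function $\rho(n)=O(n^{1/6-\epsilon})$ for which PCSC has a polynomial-time $\rho(n)$-approximation algorithm. -/

import Mathlib

open Filter Asymptotics MeasureTheory ProbabilityTheory

namespace PrecCover

/-! ### Machine model: probabilistic WHILE programs over binary trees

The data are binary trees (pure Lisp data), a store holds one tree per variable, and every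
execution step performs one elementary operation (clear, copy, cons, head, tail, coin toss, test).
This is the classical WHILE language with unit cost, extended by a fair-coin instruction; it is
polynomially equivalent to (probabilistic) Turing machines. -/

/-- Binary trees. The empty tree plays the role of `false`, every other tree that of `true`. -/
inductive Data : Type where
  | nil : Data
  | cons : Data → Data → Data

namespace Data

/-- The number of inner nodes (cons cells). -/
def size : Data → ℕ
  | nil => 0
  | cons a b => a.size + b.size + 1

def head : Data → Data
  | nil => nil
  | cons a _ => a

def tail : Data → Data
  | nil => nil
  | cons _ b => b

def ofBool : Bool → Data
  | false => nil
  | true => cons nil nil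

def ofList : List Data → Data
  | [] => nil
  | a :: l => cons a (ofList l)

/-- A vector of truth values, as a list of bits. -/
noncomputable def ofVector {k : ℕ} (p : Fin k → Prop) : Data :=
  open Classical in ofList ((List.finRange k).map fun i => ofBool (decide (p i)))

/-- A matrix of truth values, as the list of its rows. -/
noncomputable def ofMatrix {k l : ℕ} (p : Fin k → Fin l → Prop) : Data :=
  ofList ((List.finRange k).map fun i => ofVector (p i))

/-- A natural number in unary. -/
def ofUnary (n : ℕ) : Data :=
  ofList (List.replicate n nil)

/-- A natural number in binary, least significant bit first. -/
def ofBinary (n : ℕ) : Data :=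
  ofList (n.bits.map ofBool)

end Data

/-- Programs. Variables are named by natural numbers. -/
inductive Prog : Type where
  /-- `x := nil` -/
  | clear (x : ℕ)
  /-- `x := y` -/
  | copy (x y : ℕ)
  /-- `x := cons y z` -/
  | cons (x y z : ℕ)
  /-- `x := head y` -/
  | head (x y : ℕ)
  /-- `x := tail y` -/
  | tail (x y : ℕ)
  /-- `x :=` a fair random bit, independent of everything before -/
  | toss (x : ℕ)
  /-- `c; d` -/
  | seq (c d : Prog)
  /-- `if x ≠ nil then c else d` -/
  | ite (x : ℕ) (c d : Prog)
  /-- `while x ≠ nil do c` -/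
  | loop (x : ℕ) (c : Prog)

/-- The contents of the variables. -/
abbrev Store : Type := ℕ → Data

/-- What remains to be executed, with the current store. The program has halted if nothing
remains. -/
abbrev Config : Type := List Prog × Store

/-- One execution step. -/
noncomputable def step : Config → PMF Config
  | ([], s) => PMF.pure ([], s)
  | (Prog.clear x :: K, s) => PMF.pure (K, Function.update s x Data.nil)
  | (Prog.copy x y :: K, s) => PMF.pure (K, Function.update s x (s y))
  | (Prog.cons x y z :: K, s) => PMF.pure (K, Function.update s x (Data.cons (s y) (s z)))
  | (Prog.head x y :: K, s) => PMF.pure (K, Function.update s x (s y).head)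
  | (Prog.tail x y :: K, s) => PMF.pure (K, Function.update s x (s y).tail)
  | (Prog.toss x :: K, s) =>
      (PMF.uniformOfFintype Bool).map fun b => (K, Function.update s x (Data.ofBool b))
  | (Prog.seq c d :: K, s) => PMF.pure (c :: d :: K, s)
  | (Prog.ite x c d :: K, s) =>
      match s x with
      | Data.nil => PMF.pure (d :: K, s)
      | Data.cons _ _ => PMF.pure (c :: K, s)
  | (Prog.loop x c :: K, s) =>
      match s x with
      | Data.nil => PMF.pure (K, s)
      | Data.cons _ _ => PMF.pure (c :: Prog.loop x c :: K, s)

/-- The distribution of the configuration after `t` steps. -/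
noncomputable def runFor : ℕ → Config → PMF Config
  | 0, cfg => PMF.pure cfg
  | t + 1, cfg => (step cfg).bind (runFor t)

/-- The input is placed in variable `0`, all other variables are empty. -/
def initConfig (c : Prog) (x : Data) : Config :=
  ([c], Function.update (fun _ => Data.nil) 0 x)

/-- `c` runs in polynomial time: for some polynomial `p`, on every input `x` and for every outcome
of the coin tosses it halts within `p (size x)` steps. -/
def PolyTime (c : Prog) : Prop :=
  ∃ p : Polynomial ℕ, ∀ x : Data,
    ∀ cfg ∈ (runFor (p.eval x.size) (initConfig c x)).support, cfg.1 = []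

/-- The probability, over the coin tosses, that `c` on input `x` halts with an output (the content
of variable `0`) in `A`. The probabilities on the right increase with `t`. -/
noncomputable def outputProb (c : Prog) (x : Data) (A : Set Data) : ENNReal :=
  ⨆ t : ℕ, (runFor t (initConfig c x)).toOuterMeasure {cfg | cfg.1 = [] ∧ cfg.2 0 ∈ A}

/-! ### Planted dense subgraphs -/

/-- A graph on `{0, …, N - 1}`, given by its adjacency matrix. -/
noncomputable def encodeGraph {N : ℕ} (G : SimpleGraph (Fin N)) : Data :=
  Data.ofMatrix G.Adj

/-- The number `N ^ a` as a probability. (For `a < 0` and `N : ℕ` it lies in `[0, 1]` already, so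
that the truncation has no effect.) -/
noncomputable def powProb (N : ℕ) (a : ℝ) : unitInterval :=
  Set.projIcc 0 1 zero_le_one ((N : ℝ) ^ a)

/-- The graph `G` with the subgraph induced on `S` replaced by that of `H`. -/
def plant {N : ℕ} (S : Finset (Fin N)) (G H : SimpleGraph (Fin N)) : SimpleGraph (Fin N) where
  Adj u v := (u ∈ S ∧ v ∈ S ∧ H.Adj u v) ∨ (¬(u ∈ S ∧ v ∈ S) ∧ G.Adj u v)
  symm := ⟨by
    rintro u v (⟨hu, hv, h⟩ | ⟨h, h'⟩)
    · exact Or.inl ⟨hv, hu, h.symm⟩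
    · exact Or.inr ⟨fun hh => h ⟨hh.2, hh.1⟩, h'.symm⟩⟩
  loopless := ⟨by
    rintro u (⟨_, _, h⟩ | ⟨_, h⟩)
    · exact H.loopless.irrefl _ h
    · exact G.loopless.irrefl _ h⟩

/-- The random graph `G(N, p)` with a planted subgraph of size `k` and edge density `q`: choose a
set `S` of `k` vertices uniformly at random; pairs inside `S` are edges with probability `q`, all
other pairs with probability `p`, independently. -/
noncomputable def plantedGraph (N k : ℕ) (p q : unitInterval) : Measure (SimpleGraph (Fin N)) :=
  (N.choose k : ENNReal)⁻¹ • ∑ S ∈ Finset.powersetCard k (Finset.univ : Finset (Fin N)),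
    ((SimpleGraph.binomialRandom (Fin N) p).prod (SimpleGraph.binomialRandom (Fin N) q)).map
      fun GH => plant S GH.1 GH.2

/-- The probability that `c` recognizes which case it is given, when with probability `1/2` its
input is drawn from `G(N, N ^ (α - 1))` (correct output: `nil`), and with probability `1/2` from
`G(N, N ^ (α - 1))` with a planted subgraph of size `k` and edge density `k ^ (β - 1)` (correct
output: anything but `nil`). -/
noncomputable def pdsSuccess (α β : ℝ) (k N : ℕ) (c : Prog) : ENNReal :=
  (1 / 2) * (∫⁻ G, outputProb c (encodeGraph G) {Data.nil}
      ∂(SimpleGraph.binomialRandom (Fin N) (powProb N (α - 1)))) +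
  (1 / 2) * (∫⁻ G, outputProb c (encodeGraph G) {Data.nil}ᶜ
      ∂(plantedGraph N k (powProb N (α - 1)) (powProb k (β - 1))))

/-- For planted subgraphs of size `k N`, no probabilistic polynomial-time algorithm distinguishes
the two distributions with a constant advantage `δ > 0` for all large `N`. -/
def PDSHard (α β : ℝ) (k : ℕ → ℕ) : Prop :=
  ¬ ∃ (c : Prog) (δ : ℝ), PolyTime c ∧ 0 < δ ∧
    ∀ᶠ N : ℕ in atTop, 1 / 2 + ENNReal.ofReal δ ≤ pdsSuccess α β (k N) N c

/-- The Planted Dense Subgraph conjecture, for planted subgraphs of size `⌊√N⌋`. -/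
def PDSConjecture : Prop :=
  ∀ α β : ℝ, 0 < β → β < α → α < 1 → PDSHard α β Nat.sqrt

/-! ### Precedence constrained set cover -/

/-- An instance: a universe of `n` items, an (indexed) family of `m` subsets, a partial order on
the family, and the fraction `f` of the items to be covered. -/
structure Instance where
  n : ℕ
  m : ℕ
  sets : Fin m → Finset (Fin n)
  /-- `prec A B` means that `A` is a predecessor of `B`. -/
  prec : Fin m → Fin m → Prop
  prec_refl : ∀ A, prec A A
  prec_trans : ∀ A B C, prec A B → prec B C → prec A C
  prec_antisymm : ∀ A B, prec A B → prec B A → A = B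
  f : ℚ
  f_pos : 0 < f
  f_le_one : f ≤ 1

namespace Instance

/-- A precedence-closed subfamily that covers at least `f * n` items. -/
def IsSolution (I : Instance) (C : Finset (Fin I.m)) : Prop :=
  (∀ A ∈ C, ∀ B, I.prec B A → B ∈ C) ∧ I.f * I.n ≤ ((C.biUnion I.sets).card : ℚ)

def Feasible (I : Instance) : Prop :=
  ∃ C, I.IsSolution C

/-- The least number of sets in a solution (meaningful for feasible instances). -/
noncomputable def opt (I : Instance) : ℕ :=
  sInf {k | ∃ C, I.IsSolution C ∧ C.card = k}

/-- The universe in unary, the incidence matrix, the matrix of the order, and `f` in binary. -/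
noncomputable def encode (I : Instance) : Data :=
  Data.ofList [Data.ofUnary I.n, Data.ofMatrix fun A j => j ∈ I.sets A, Data.ofMatrix I.prec,
    Data.ofBinary I.f.num.toNat, Data.ofBinary I.f.den]

/-- A subfamily as an output: its characteristic vector. -/
noncomputable def encodeFamily (I : Instance) (C : Finset (Fin I.m)) : Data :=
  Data.ofVector fun A => A ∈ C

end Instance

/-- `c` is a probabilistic polynomial-time algorithm that, on each feasible instance `I`, finds
with probability at least `2/3` a solution of size at most `ρ I` times the optimum. -/
def IsApproxAlgorithm (c : Prog) (ρ : Instance → ℝ) : Prop :=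
  PolyTime c ∧ ∀ I : Instance, I.Feasible →
    2 / 3 ≤ outputProb c I.encode
      {d | ∃ C, d = I.encodeFamily C ∧ I.IsSolution C ∧ (C.card : ℝ) ≤ ρ I * I.opt}

end PrecCover

/-! An approximation algorithm with a too good ratio would tell a planted graph from a random one.
For a constant `h`, let `w = ⌊N^(1/(6h))⌋`, `r = w^(4h)` (about `N^(2/3)`), `V = w^(4h-1)` and `k =
⌊√N⌋`.

A graph on `N` vertices becomes an instance with `N` empty sets ("copies") per vertex and one set
per ordered pair of vertices. A pair must be preceded by all copies of its two endpoints, so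
vertices are expensive and pairs cheap. An edge `(u, v)` covers the item `u + v`: hashing edges by
the sum keeps the number of items linear in `N`. The pairs `(u, u)` need all copies and cover
everything, which makes every instance feasible. Padding turns the requirement "half of the items"
into "`r` different edge sums".

If no `V` vertices span `r` edges, every solution has at least `N * V` sets
(`le_card_of_isSolution`). If some `k` vertices span edges with `r` different sums, there is a
solution with at most `2 * k * N` sets (`exists_isSolution`). The gap `V / (2 * k)` is `N^(1/6 -
1/(6h))` up to constants (`ratio_lt`), while the instance has `m = 2 * N^2` sets and `n ≤ 6 * N`
items; this gives the exponents `1/12` and `1/6`.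

In `G(N, p)` with `p ≤ 1/V`, a union bound over `V`-sets together with the moment `E 2^X = (1 +
p)^|I|` yields the first situation (`null_error_le`). In the planted graph, Chebyshev's inequality
gives more than `2 * r` edges inside `S`, and Markov's inequality, averaged over `S`, gives fewer
than `r` pairs of edges with equal sums (`le_plantedGraph`, `planted_error_le`). Comparing the size
of the computed solution with `N * V` therefore decides between the two distributions with advantage
`1/12` (`PDSConjecture.not_isApproxAlgorithm`).

The machine model is concrete, so the reduction must also be a program: `Comp` and `PT` collect
functions computable in polynomial time, and `exists_prog_countDown` uses an arbitrary probabilistic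
program as a subroutine. -/

namespace PrecCover

/-! ### Executions of programs -/

/-- All variables of the program are less than `B`. -/
def Prog.VarsBelow (B : ℕ) : Prog → Prop
  | .clear x => x < B
  | .copy x y => x < B ∧ y < B
  | .cons x y z => x < B ∧ y < B ∧ z < B
  | .head x y => x < B ∧ y < B
  | .tail x y => x < B ∧ y < B
  | .toss x => x < B
  | .seq c d => c.VarsBelow B ∧ d.VarsBelow B
  | .ite x c d => x < B ∧ c.VarsBelow B ∧ d.VarsBelow B
  | .loop x c => x < B ∧ c.VarsBelow B

theorem Prog.VarsBelow.mono {B B' : ℕ} (h : B ≤ B') : ∀ c : Prog, c.VarsBelow B → c.VarsBelow B'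
  | .clear x => by simp only [VarsBelow]; omega
  | .copy x y => by simp only [VarsBelow]; omega
  | .cons x y z => by simp only [VarsBelow]; omega
  | .head x y => by simp only [VarsBelow]; omega
  | .tail x y => by simp only [VarsBelow]; omega
  | .toss x => by simp only [VarsBelow]; omega
  | .seq c d => fun hc => ⟨mono h c hc.1, mono h d hc.2⟩
  | .ite x c d => fun hc => ⟨hc.1.trans_le h, mono h c hc.2.1, mono h d hc.2.2⟩
  | .loop x c => fun hc => ⟨hc.1.trans_le h, mono h c hc.2⟩

theorem Prog.exists_varsBelow : ∀ c : Prog, ∃ B, c.VarsBelow B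
  | .clear x => ⟨x + 1, by simp [VarsBelow]⟩
  | .copy x y => ⟨x + y + 1, by simp only [VarsBelow]; omega⟩
  | .cons x y z => ⟨x + y + z + 1, by simp only [VarsBelow]; omega⟩
  | .head x y => ⟨x + y + 1, by simp only [VarsBelow]; omega⟩
  | .tail x y => ⟨x + y + 1, by simp only [VarsBelow]; omega⟩
  | .toss x => ⟨x + 1, by simp [VarsBelow]⟩
  | .seq c d => by
    obtain ⟨B, hB⟩ := exists_varsBelow c
    obtain ⟨B', hB'⟩ := exists_varsBelow d
    exact ⟨B + B', VarsBelow.mono (by omega) _ hB, VarsBelow.mono (by omega) _ hB'⟩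
  | .ite x c d => by
    obtain ⟨B, hB⟩ := exists_varsBelow c
    obtain ⟨B', hB'⟩ := exists_varsBelow d
    exact ⟨B + B' + x + 1, by omega, VarsBelow.mono (by omega) _ hB,
      VarsBelow.mono (by omega) _ hB'⟩
  | .loop x c => by
    obtain ⟨B, hB⟩ := exists_varsBelow c
    exact ⟨B + x + 1, by omega, VarsBelow.mono (by omega) _ hB⟩

/-- The store that agrees with `s` below `B` and with `σ` from `B` on. -/
def mergeStore (B : ℕ) (σ s : Store) : Store := fun i => if i < B then s i else σ i

theorem mergeStore_of_lt {B : ℕ} {σ s : Store} {i : ℕ} (h : i < B) : mergeStore B σ s i = s i :=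
  if_pos h

theorem mergeStore_of_le {B : ℕ} {σ s : Store} {i : ℕ} (h : B ≤ i) : mergeStore B σ s i = σ i :=
  if_neg (by omega)

theorem update_mergeStore {B : ℕ} {σ s : Store} {i : ℕ} (h : i < B) (d : Data) :
    Function.update (mergeStore B σ s) i d = mergeStore B σ (Function.update s i d) := by
  funext j
  by_cases hj : j = i
  · subst hj; simp [mergeStore, h]
  · simp [mergeStore, hj]

/-- A configuration with the continuation `K` appended and the store merged into `σ`. -/
def embedConfig (B : ℕ) (σ : Store) (K : List Prog) (cfg : Config) : Config :=
  (cfg.1 ++ K, mergeStore B σ cfg.2)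

/-- A program confined to variables below `B` sees neither the values merged in from `σ` nor the
continuation. The list must be nonempty: otherwise the left-hand side would already execute `K`. -/
theorem step_embedConfig {B : ℕ} {σ : Store} {K : List Prog} (c : Prog) (L : List Prog) (s : Store)
    (hc : c.VarsBelow B) :
    step (embedConfig B σ K (c :: L, s)) = (step (c :: L, s)).map (embedConfig B σ K) := by
  cases c <;> simp only [Prog.VarsBelow] at hc
  case toss x =>
    simp only [embedConfig, List.cons_append, step, PMF.map_comp]
    congr 1
    funext b
    simp [update_mergeStore hc, embedConfig]
  case ite x c d =>
    simp only [embedConfig, List.cons_append, step, mergeStore_of_lt hc.1]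
    cases s x <;> simp [PMF.pure_map, embedConfig]
  case loop x c =>
    simp only [embedConfig, List.cons_append, step, mergeStore_of_lt hc.1]
    cases s x <;> simp [PMF.pure_map, embedConfig]
  all_goals simp_all [embedConfig, step, PMF.pure_map, update_mergeStore, mergeStore_of_lt]

theorem varsBelow_of_mem_support_step {B : ℕ} {L : List Prog} {s : Store}
    (hL : ∀ c ∈ L, c.VarsBelow B) {cfg : Config} (h : cfg ∈ (step (L, s)).support) :
    ∀ c ∈ cfg.1, c.VarsBelow B := by
  cases L with
  | nil => simp only [step, PMF.support_pure, Set.mem_singleton_iff] at h; subst h; exact hL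
  | cons c L =>
    simp only [List.forall_mem_cons] at hL
    cases c
    case toss x =>
      simp only [step, PMF.support_map, Set.mem_image] at h
      obtain ⟨b, -, rfl⟩ := h
      exact hL.2
    case ite x c d =>
      obtain ⟨⟨-, h1, h2⟩, hL⟩ := hL
      simp only [step] at h
      split at h <;> simp only [PMF.support_pure, Set.mem_singleton_iff] at h <;> subst h <;>
        simp_all
    case loop x c =>
      obtain ⟨⟨h0, h1⟩, hL⟩ := hL
      simp only [step] at h
      split at h <;> simp only [PMF.support_pure, Set.mem_singleton_iff] at h <;> subst h <;>
        simp_all [Prog.VarsBelow]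
    case seq c d =>
      obtain ⟨⟨h1, h2⟩, hL⟩ := hL
      simp only [step, PMF.support_pure, Set.mem_singleton_iff] at h
      subst h
      simp_all
    all_goals
      simp only [step, PMF.support_pure, Set.mem_singleton_iff] at h
      subst h
      exact hL.2

theorem runFor_nil (t : ℕ) (s : Store) : runFor t ([], s) = PMF.pure ([], s) := by
  induction t with
  | zero => rfl
  | succ t ih => rw [runFor, step, PMF.pure_bind, ih]

theorem runFor_add (t u : ℕ) (cfg : Config) :
    runFor (t + u) cfg = (runFor t cfg).bind (runFor u) := by
  induction t generalizing cfg with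
  | zero => simp [runFor]
  | succ t ih =>
    rw [Nat.add_right_comm, runFor, runFor, PMF.bind_bind]
    congr 1
    funext cfg'
    exact ih cfg'

/-- The halted configurations with output in `A`. -/
def haltedIn (A : Set Data) : Set Config := {cfg | cfg.1 = [] ∧ cfg.2 0 ∈ A}

/-- This is the rule for calling a probabilistic program as a subroutine. The induction follows its
steps; once it has halted, possibly early, the continuation takes over with at least `τ` steps left,
which is why `hK` speaks of all `u ≥ τ`. -/
theorem runFor_embedConfig_le {B τ : ℕ} {σ : Store} {K : List Prog} {A A' : Set Data}
    (hK : ∀ s : Store, s 0 ∈ A → ∀ u, τ ≤ u →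
      (runFor u (K, mergeStore B σ s)).toOuterMeasure (haltedIn A') = 1) (t : ℕ) :
    ∀ (L : List Prog) (s : Store), (∀ c ∈ L, c.VarsBelow B) →
    (runFor t (L, s)).toOuterMeasure (haltedIn A) ≤
      (runFor (t + τ) (embedConfig B σ K (L, s))).toOuterMeasure (haltedIn A') := by
  induction t with
  | zero =>
    intro L s _
    simp only [runFor, PMF.toOuterMeasure_pure_apply]
    split_ifs with h
    · obtain ⟨h1, h2⟩ := h
      dsimp only at h1 h2
      subst h1
      exact (hK s h2 _ (by omega)).ge
    · exact zero_le
  | succ t ih =>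
    intro L s hL
    cases L with
    | nil =>
      simp only [runFor_nil, PMF.toOuterMeasure_pure_apply]
      split_ifs with h
      · exact (hK s h.2 _ (by omega)).ge
      · exact zero_le
    | cons c L =>
      rw [Nat.add_right_comm, runFor, runFor, step_embedConfig c L s (hL c (by simp)),
        PMF.bind_map, PMF.toOuterMeasure_bind_apply, PMF.toOuterMeasure_bind_apply]
      refine ENNReal.tsum_le_tsum fun cfg => ?_
      by_cases h : cfg ∈ (step (c :: L, s)).support
      · refine mul_le_mul' le_rfl ?_
        exact ih cfg.1 cfg.2 (varsBelow_of_mem_support_step hL h)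
      · rw [(PMF.apply_eq_zero_iff _ _).2 h]; simp

/-- The program `c` turns the store `s` into `s'` in exactly `t` steps, without coin tosses. -/
def Exec (c : Prog) (s : Store) (t : ℕ) (s' : Store) : Prop :=
  ∀ K : List Prog, runFor t (c :: K, s) = PMF.pure (K, s')

namespace Exec

theorem clear (x : ℕ) (s : Store) : Exec (.clear x) s 1 (Function.update s x .nil) := by
  intro K; simp [runFor, step]

theorem copy (x y : ℕ) (s : Store) : Exec (.copy x y) s 1 (Function.update s x (s y)) := by
  intro K; simp [runFor, step]

theorem cons (x y z : ℕ) (s : Store) :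
    Exec (.cons x y z) s 1 (Function.update s x (.cons (s y) (s z))) := by
  intro K; simp [runFor, step]

theorem head (x y : ℕ) (s : Store) : Exec (.head x y) s 1 (Function.update s x (s y).head) := by
  intro K; simp [runFor, step]

theorem tail (x y : ℕ) (s : Store) : Exec (.tail x y) s 1 (Function.update s x (s y).tail) := by
  intro K; simp [runFor, step]

theorem seq {c d : Prog} {s s' s'' : Store} {t u : ℕ} (hc : Exec c s t s') (hd : Exec d s' u s'') :
    Exec (.seq c d) s (t + u + 1) s'' := by
  intro K
  rw [runFor, step, PMF.pure_bind, runFor_add, hc, PMF.pure_bind, hd]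

theorem ite_nil {x : ℕ} {c d : Prog} {s s' : Store} {t : ℕ} (hx : s x = .nil)
    (hd : Exec d s t s') : Exec (.ite x c d) s (t + 1) s' := by
  intro K
  rw [runFor, step, hx]
  simp only [PMF.pure_bind, hd K]

theorem ite_cons {x : ℕ} {c d : Prog} {s s' : Store} {t : ℕ} {a b : Data} (hx : s x = .cons a b)
    (hc : Exec c s t s') : Exec (.ite x c d) s (t + 1) s' := by
  intro K
  rw [runFor, step, hx]
  simp only [PMF.pure_bind, hc K]

theorem loop_nil {x : ℕ} {c : Prog} {s : Store} (hx : s x = .nil) : Exec (.loop x c) s 1 s := by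
  intro K
  rw [runFor, step, hx]
  simp [runFor]

theorem loop_cons {x : ℕ} {c : Prog} {s s' s'' : Store} {t u : ℕ} {a b : Data}
    (hx : s x = .cons a b) (hc : Exec c s t s') (hl : Exec (.loop x c) s' u s'') :
    Exec (.loop x c) s (t + u + 1) s'' := by
  intro K
  rw [runFor, step, hx]
  simp only [PMF.pure_bind]
  rw [runFor_add, hc, PMF.pure_bind, hl]

theorem toOuterMeasure_eq_one {c : Prog} {s s' : Store} {t u : ℕ} (h : Exec c s t s') (hu : t ≤ u)
    {A : Set Data} (hA : s' 0 ∈ A) :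
    (runFor u ([c], s)).toOuterMeasure (haltedIn A) = 1 := by
  obtain ⟨v, rfl⟩ := Nat.exists_eq_add_of_le hu
  rw [runFor_add, h, PMF.pure_bind, runFor_nil, PMF.toOuterMeasure_pure_apply, if_pos ⟨rfl, hA⟩]

end Exec

theorem runFor_exec_add {c : Prog} {s s' : Store} {t : ℕ} (h : Exec c s t s') (K : List Prog)
    (u : ℕ) : runFor (t + u) (c :: K, s) = runFor u (K, s') := by
  rw [runFor_add, h, PMF.pure_bind]

theorem polynomial_eval_mono (p : Polynomial ℕ) {a b : ℕ} (h : a ≤ b) : p.eval a ≤ p.eval b := by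
  rw [Polynomial.eval_eq_sum, Polynomial.eval_eq_sum]
  exact Finset.sum_le_sum fun i _ => Nat.mul_le_mul_left _ (Nat.pow_le_pow_left h i)

/-- Sure halting is rewritten as a probability, so that the same comparison of probabilities
transfers both outputs and running times. -/
theorem polyTime_iff_toOuterMeasure {t : ℕ} {cfg : Config} :
    (∀ cfg' ∈ (runFor t cfg).support, cfg'.1 = []) ↔
      (runFor t cfg).toOuterMeasure (haltedIn Set.univ) = 1 := by
  rw [PMF.toOuterMeasure_apply_eq_one_iff]
  exact ⟨fun h cfg hc => ⟨h cfg hc, trivial⟩, fun h cfg hc => (h hc).1⟩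

theorem toOuterMeasure_le_one {α : Type*} (p : PMF α) (A : Set α) : p.toOuterMeasure A ≤ 1 :=
  (p.toOuterMeasure.mono (Set.subset_univ A)).trans
    (((PMF.toOuterMeasure_apply_eq_one_iff p Set.univ).2 (Set.subset_univ _)).le)

/-- Halted configurations are fixed by `step`. -/
theorem haltedIn_mono_time {A : Set Data} {t u : ℕ} (h : t ≤ u) (cfg : Config) :
    (runFor t cfg).toOuterMeasure (haltedIn A) ≤ (runFor u cfg).toOuterMeasure (haltedIn A) := by
  obtain ⟨v, rfl⟩ := Nat.exists_eq_add_of_le h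
  rw [runFor_add, PMF.toOuterMeasure_bind_apply, PMF.toOuterMeasure_apply]
  refine ENNReal.tsum_le_tsum fun cfg' => ?_
  by_cases hc : cfg' ∈ haltedIn A
  · obtain ⟨L, s⟩ := cfg'
    have hL : L = [] := hc.1
    subst hL
    rw [runFor_nil, PMF.toOuterMeasure_pure_apply, if_pos hc, mul_one]
    exact Set.indicator_le_self _ _ _
  · rw [Set.indicator_of_notMem hc]; exact zero_le

/-! ### Polynomial-time computable functions on data -/

namespace Data

theorem size_head_le (d : Data) : d.head.size ≤ d.size := by
  cases d <;> simp only [head, size] <;> omega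

theorem size_tail_le (d : Data) : d.tail.size ≤ d.size := by
  cases d <;> simp only [tail, size] <;> omega

/-- The list of the entries along the spine. -/
def toList : Data → List Data
  | nil => []
  | cons a b => a :: b.toList

@[simp]
theorem toList_ofList (l : List Data) : (ofList l).toList = l := by
  induction l with
  | nil => rfl
  | cons a l ih => simp [ofList, toList, ih]

@[simp]
theorem ofList_toList (d : Data) : ofList d.toList = d := by
  induction d with
  | nil => rfl
  | cons a b _ ih => simp [ofList, toList, ih]

theorem size_ofList (l : List Data) : (ofList l).size = (l.map fun a => a.size + 1).sum := by
  induction l with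
  | nil => rfl
  | cons a l ih => simp only [ofList, size, ih, List.map_cons, List.sum_cons]; omega

theorem length_le_size_ofList (l : List Data) : l.length ≤ (ofList l).size := by
  induction l with
  | nil => simp
  | cons a l ih => simp only [ofList, size, List.length_cons]; omega

theorem size_le_of_mem {l : List Data} {a : Data} (h : a ∈ l) : a.size ≤ (ofList l).size := by
  induction l with
  | nil => simp at h
  | cons b l ih =>
    simp only [ofList, size]
    rcases List.mem_cons.1 h with rfl | h
    · omega
    · have := ih h; omega

theorem size_ofList_append (l l' : List Data) :
    (ofList (l ++ l')).size = (ofList l).size + (ofList l').size := by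
  simp [size_ofList]

theorem size_ofList_reverse (l : List Data) : (ofList l.reverse).size = (ofList l).size := by
  simp [size_ofList]

end Data

open Data

/-- `F` is computed by a deterministic program in polynomial time, with output of polynomial size.
The input and the output are in variable `b`, and smaller variables are not modified. -/
def Comp (F : Data → Data) : Prop :=
  ∃ p : Polynomial ℕ, (∀ x, (F x).size ≤ p.eval x.size) ∧
    ∀ b, ∃ c : Prog, ∀ s : Store, ∃ t s', t ≤ p.eval (s b).size ∧ Exec c s t s' ∧
      s' b = F (s b) ∧ ∀ i < b, s' i = s i

namespace Comp

theorem congr {F G : Data → Data} (hF : Comp F) (h : ∀ x, F x = G x) : Comp G := by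
  rwa [← funext h]

theorem id : Comp fun x => x := by
  refine ⟨Polynomial.X + 1, fun x => by simp, fun b => ⟨.copy b b, fun s => ?_⟩⟩
  exact ⟨1, _, by simp, Exec.copy b b s, by simp, fun i hi => by simp [hi.ne]⟩

theorem nil : Comp fun _ => .nil := by
  refine ⟨1, fun x => by simp [size], fun b => ⟨.clear b, fun s => ?_⟩⟩
  exact ⟨1, _, by simp, Exec.clear b s, by simp, fun i hi => by simp [hi.ne]⟩

theorem head : Comp Data.head := by
  refine ⟨Polynomial.X + 1, fun x => by have := size_head_le x; simp; omega,
    fun b => ⟨.head b b, fun s => ?_⟩⟩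
  exact ⟨1, _, by simp, Exec.head b b s, by simp, fun i hi => by simp [hi.ne]⟩

theorem tail : Comp Data.tail := by
  refine ⟨Polynomial.X + 1, fun x => by have := size_tail_le x; simp; omega,
    fun b => ⟨.tail b b, fun s => ?_⟩⟩
  exact ⟨1, _, by simp, Exec.tail b b s, by simp, fun i hi => by simp [hi.ne]⟩

theorem comp {F G : Data → Data} (hF : Comp F) (hG : Comp G) : Comp fun x => F (G x) := by
  obtain ⟨p, hp, hF⟩ := hF
  obtain ⟨q, hq, hG⟩ := hG
  refine ⟨p.comp q + q + 1, fun x => ?_, fun b => ?_⟩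
  · have := (hp (G x)).trans (polynomial_eval_mono p (hq x))
    simp only [Polynomial.eval_add, Polynomial.eval_comp, Polynomial.eval_one]
    omega
  · obtain ⟨c, hc⟩ := hF b
    obtain ⟨d, hd⟩ := hG b
    refine ⟨.seq d c, fun s => ?_⟩
    obtain ⟨t, s', ht, he, hv, hf⟩ := hd s
    obtain ⟨t', s'', ht', he', hv', hf'⟩ := hc s'
    refine ⟨_, s'', ?_, he.seq he', by rw [hv', hv], fun i hi => by rw [hf' i hi, hf i hi]⟩
    rw [hv] at ht'
    have := ht'.trans (polynomial_eval_mono p (hq (s b)))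
    simp only [Polynomial.eval_add, Polynomial.eval_comp, Polynomial.eval_one]
    omega

theorem cons {F G : Data → Data} (hF : Comp F) (hG : Comp G) :
    Comp fun x => .cons (F x) (G x) := by
  obtain ⟨p, hp, hF⟩ := hF
  obtain ⟨q, hq, hG⟩ := hG
  refine ⟨p + q + 7, fun x => ?_, fun b => ?_⟩
  · have := hp x
    have := hq x
    simp only [Polynomial.eval_add, Polynomial.eval_ofNat, size]
    omega
  · obtain ⟨c, hc⟩ := hF (b + 1)
    obtain ⟨d, hd⟩ := hG (b + 2)
    refine ⟨.seq (.copy (b + 1) b) (.seq c (.seq (.copy (b + 2) b) (.seq d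
      (.cons b (b + 1) (b + 2))))), fun s => ?_⟩
    obtain ⟨t, s', ht, he, hv, hf⟩ := hc (Function.update s (b + 1) (s b))
    obtain ⟨t', s'', ht', he', hv', hf'⟩ := hd (Function.update s' (b + 2) (s' b))
    have hb : s' b = s b := by rw [hf b (by omega)]; simp
    simp only [Function.update_self] at ht ht' hv hv'
    rw [hb] at ht' hv'
    have hb1 : s'' (b + 1) = F (s b) := by rw [hf' (b + 1) (by omega)]; simp [hv]
    refine ⟨_, _, ?_, (Exec.copy _ _ _).seq (he.seq ((Exec.copy _ _ _).seq
      (he'.seq (Exec.cons _ _ _ _)))), by simp [hb1, hv'], fun i hi => ?_⟩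
    · simp only [Polynomial.eval_add, Polynomial.eval_ofNat]
      omega
    · rw [Function.update_of_ne hi.ne, hf' i (by omega), Function.update_of_ne (by omega),
        hf i (by omega), Function.update_of_ne (by omega)]

theorem const : ∀ d : Data, Comp fun _ => d
  | .nil => nil
  | .cons a b => cons (const a) (const b)

theorem cond {C F G : Data → Data} (hC : Comp C) (hF : Comp F) (hG : Comp G) :
    Comp fun x => match C x with
      | .nil => G x
      | .cons _ _ => F x := by
  obtain ⟨r, hr, hC⟩ := hC
  obtain ⟨p, hp, hF⟩ := hF
  obtain ⟨q, hq, hG⟩ := hG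
  refine ⟨p + q + r + 4, fun x => ?_, fun b => ?_⟩
  · have := hp x
    have := hq x
    simp only [Polynomial.eval_add, Polynomial.eval_ofNat]
    split <;> omega
  · obtain ⟨c, hc⟩ := hF b
    obtain ⟨d, hd⟩ := hG b
    obtain ⟨e, he⟩ := hC (b + 1)
    refine ⟨.seq (.copy (b + 1) b) (.seq e (.ite (b + 1) c d)), fun s => ?_⟩
    obtain ⟨t, s', ht, he, hv, hf⟩ := he (Function.update s (b + 1) (s b))
    simp only [Function.update_self] at ht hv
    have hb : s' b = s b := by rw [hf b (by omega)]; simp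
    have hi' : ∀ i < b, s' i = s i := fun i hi => by
      rw [hf i (by omega), Function.update_of_ne (by omega)]
    cases hx : C (s b) with
    | nil =>
      obtain ⟨t', s'', ht', he', hv', hf'⟩ := hd s'
      refine ⟨_, s'', ?_, (Exec.copy _ _ _).seq (he.seq (Exec.ite_nil (hv.trans hx) he')),
        by rw [hv', hb]; simp only [hx], fun i hi => by rw [hf' i hi, hi' i hi]⟩
      rw [hb] at ht'
      simp only [Polynomial.eval_add, Polynomial.eval_ofNat]
      omega
    | cons _ _ =>
      obtain ⟨t', s'', ht', he', hv', hf'⟩ := hc s'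
      refine ⟨_, s'', ?_, (Exec.copy _ _ _).seq (he.seq (Exec.ite_cons (hv.trans hx) he')),
        by rw [hv', hb]; simp only [hx], fun i hi => by rw [hf' i hi, hi' i hi]⟩
      rw [hb] at ht'
      simp only [Polynomial.eval_add, Polynomial.eval_ofNat]
      omega

/-- Variable `b` holds the remaining list, `b + 1` the accumulator and `b + 2` the current entry.
Since `M` bounds every future argument of `G`, one bound `p.eval M` serves all rounds; `7` counts
the elementary steps around `G` in a round. -/
theorem exec_foldl_loop {G : Data → Data} {p : Polynomial ℕ} {b : ℕ} {c : Prog}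
    (hc : ∀ s : Store, ∃ t s', t ≤ p.eval (s (b + 1)).size ∧ Exec c s t s' ∧
      s' (b + 1) = G (s (b + 1)) ∧ ∀ i < b + 1, s' i = s i) {M : ℕ} :
    ∀ (l : List Data) (s : Store), s b = ofList l →
      (∀ l₁ a l₂, l = l₁ ++ a :: l₂ →
        (Data.cons (l₁.foldl (fun st a => G (.cons st a)) (s (b + 1))) a).size ≤ M) →
      ∃ t s', t ≤ l.length * (p.eval M + 7) + 1 ∧
        Exec (.loop b (.seq (.head (b + 2) b) (.seq (.tail b b)
          (.seq (.cons (b + 1) (b + 1) (b + 2)) c)))) s t s' ∧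
        s' (b + 1) = l.foldl (fun st a => G (.cons st a)) (s (b + 1)) ∧ ∀ i < b, s' i = s i
  | [], s, hs, _ => ⟨1, s, by simp, Exec.loop_nil hs, rfl, fun _ _ => rfl⟩
  | a :: l, s, hs, hM => by
    set s₁ := Function.update s (b + 2) (s b).head with hs₁
    set s₂ := Function.update s₁ b (s₁ b).tail with hs₂
    set s₃ := Function.update s₂ (b + 1) (.cons (s₂ (b + 1)) (s₂ (b + 2))) with hs₃
    have h1 : s₁ b = s b := by simp [hs₁]
    have h2 : s₃ (b + 1) = .cons (s (b + 1)) a := by simp [hs₃, hs₂, hs₁, hs, ofList, Data.head]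
    have h3 : s₃ b = ofList l := by simp [hs₃, hs₂, h1, hs, ofList, Data.tail]
    have h4 : ∀ i < b, s₃ i = s i := fun i hi => by
      rw [hs₃, Function.update_of_ne (by omega), hs₂, Function.update_of_ne (by omega), hs₁,
        Function.update_of_ne (by omega)]
    obtain ⟨t, s₄, ht, he, hv, hf⟩ := hc s₃
    rw [h2] at hv ht
    obtain ⟨t', s', ht', he', hv', hf'⟩ := exec_foldl_loop hc l s₄ (by rw [hf b (by omega), h3])
      fun l₁ a' l₂ h => by simpa [hv] using hM (a :: l₁) a' l₂ (by simp [h])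
    refine ⟨_, s', ?_, Exec.loop_cons hs ((Exec.head _ _ _).seq ((Exec.tail _ _ _).seq
      ((Exec.cons _ _ _ _).seq he))) he', by rw [hv', hv, List.foldl_cons], fun i hi => by
        rw [hf' i hi, hf i (by omega), h4 i hi]⟩
    have := ht.trans (polynomial_eval_mono p (hM [] a l rfl))
    rw [List.length_cons, Nat.succ_mul]
    omega

/-- Folding over the first component of the input, starting with the second one, if the sizes of
the intermediate results are polynomially bounded. -/
theorem foldl {G : Data → Data} (hG : Comp G) {q : Polynomial ℕ}
    (hq : ∀ (l l' : List Data) (st : Data),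
      (l.foldl (fun st a => G (.cons st a)) st).size ≤
        q.eval ((ofList (l ++ l')).size + st.size)) :
    Comp fun x => x.head.toList.foldl (fun st a => G (.cons st a)) x.tail := by
  obtain ⟨p, -, hG⟩ := hG
  have hsz : ∀ x : Data, (ofList x.head.toList).size + x.tail.size ≤ x.size := fun x => by
    cases x <;> simp [Data.head, Data.tail, size]
  refine ⟨Polynomial.X * (p.comp (q + Polynomial.X + 1) + 7) + q + 10, fun x => ?_, fun b => ?_⟩
  · have hx := (hq x.head.toList [] x.tail).trans
      (polynomial_eval_mono q (by simpa using hsz x))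
    simp only [Polynomial.eval_add, Polynomial.eval_ofNat]
    omega
  · obtain ⟨c, hc⟩ := hG (b + 1)
    refine ⟨.seq (.tail (b + 1) b) (.seq (.head b b) (.seq
      (.loop b (.seq (.head (b + 2) b) (.seq (.tail b b)
          (.seq (.cons (b + 1) (b + 1) (b + 2)) c)))) (.copy b (b + 1)))), fun s => ?_⟩
    set s₁ := Function.update s (b + 1) (s b).tail with hs₁
    set s₂ := Function.update s₁ b (s₁ b).head with hs₂
    have h1 : s₂ b = ofList (s b).head.toList := by simp [hs₂, hs₁]
    have h2 : s₂ (b + 1) = (s b).tail := by simp [hs₂, hs₁]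
    have h3 : ∀ i < b, s₂ i = s i := fun i hi => by
      rw [hs₂, Function.update_of_ne (by omega), hs₁, Function.update_of_ne (by omega)]
    -- Each accumulator comes from a prefix `l₁`, and `hq` bounds it by the size of the whole list;
    -- the current entry accounts for `X` and the pairing for `1`.
    obtain ⟨t, s', ht, he, hv, hf⟩ := exec_foldl_loop hc (M := (q + Polynomial.X + 1).eval
      (s b).size) _ s₂ h1 fun l₁ a l₂ h => by
        have e1 := hsz (s b)
        have e2 := hq l₁ (a :: l₂) (s b).tail
        rw [← h] at e2
        have e3 := polynomial_eval_mono q e1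
        have e4 : a.size ≤ (ofList (s b).head.toList).size :=
          size_le_of_mem (by rw [h]; simp)
        simp only [h2, size, Polynomial.eval_add, Polynomial.eval_X, Polynomial.eval_one]
        omega
    refine ⟨_, _, ?_, (Exec.tail _ _ _).seq ((Exec.head _ _ _).seq (he.seq (Exec.copy _ _ _))),
      by simp [hv, h2], fun i hi => by rw [Function.update_of_ne hi.ne, hf i hi, h3 i hi]⟩
    have e1 := (length_le_size_ofList (s b).head.toList).trans (Nat.le_of_add_right_le (hsz (s b)))
    have e2 := Nat.mul_le_mul_right (Polynomial.eval (Polynomial.eval (s b).size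
      (q + Polynomial.X + 1)) p + 7) e1
    simp only [Polynomial.eval_add, Polynomial.eval_mul, Polynomial.eval_X, Polynomial.eval_comp,
      Polynomial.eval_ofNat, Polynomial.eval_one] at ht e2 ⊢
    omega

end Comp

/-! ### List operations in polynomial time -/

namespace Comp

/-- One entry of the second list is removed per entry of the first. With unary numbers this yields
both comparison and indexing. -/
theorem drop : Comp fun x => x.head.toList.foldl (fun st _ => st.tail) x.tail := by
  refine (foldl (G := fun x => x.head.tail) (tail.comp head) (q := Polynomial.X)
    fun l l' st => ?_).congr fun x => rfl
  have : ∀ st : Data, (l.foldl (fun st _ => st.tail) st).size ≤ st.size := by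
    induction l with
    | nil => simp
    | cons a l ih => exact fun st => (ih _).trans (size_tail_le st)
  have := this st
  simp only [Data.head, Polynomial.eval_X]
  omega

/-- A fold passes only the accumulator and the entry to its body, so the parameter `e` travels in
the head of the accumulator. -/
theorem foldl_cons_map (F : Data → Data) (e : Data) (l l' : List Data) :
    l.foldl (fun st a => Data.cons st.head (.cons (F (.cons st.head a)) st.tail))
      (.cons e (ofList l')) = .cons e (ofList ((l.map fun a => F (.cons e a)).reverse ++ l')) := by
  induction l generalizing l' with
  | nil => simp
  | cons a l ih => simpa [Data.head, Data.tail, ofList] using ih (F (.cons e a) :: l')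

theorem mapReverse {F : Data → Data} (hF : Comp F) :
    Comp fun x => ofList ((x.tail.toList.map fun a => F (.cons x.head a)).reverse) := by
  have ⟨p, hp, _⟩ := hF
  have h : Comp fun x => x.head.toList.foldl
      (fun st a => Data.cons st.head (.cons (F (.cons st.head a)) st.tail)) x.tail := by
    refine (foldl (G := fun x => Data.cons x.head.head (.cons (F (.cons x.head.head x.tail))
      x.head.tail)) (cons (head.comp head) (cons (hF.comp (cons (head.comp head) tail))
      (tail.comp head))) (q := Polynomial.X + Polynomial.X * (p.comp (Polynomial.X + 1) + 2))
      fun l l' st => ?_).congr fun x => rfl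
    -- The parameter never changes, so the results of `F` have a common bound `M` and the
    -- accumulator grows only linearly.
    have key : ∀ (M : ℕ) (st : Data), (∀ a ∈ l, (F (.cons st.head a)).size ≤ M) →
        (l.foldl (fun st a => Data.cons st.head (.cons (F (.cons st.head a)) st.tail)) st).size ≤
          st.size + l.length * (M + 2) := by
      intro M
      clear hF
      induction l with
      | nil => simp
      | cons a l ih =>
        intro st hst
        have h1 := hst a (by simp)
        have h2 := ih (.cons st.head (.cons (F (.cons st.head a)) st.tail))
          fun b hb => hst b (by simp [hb])
        rw [List.foldl_cons, List.length_cons, Nat.succ_mul]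
        refine h2.trans ?_
        have : st.head.size + st.tail.size ≤ st.size := by
          cases st <;> simp [Data.head, Data.tail, size]
        simp only [size]
        omega
    refine (key (p.eval ((ofList (l ++ l')).size + st.size + 1)) st fun a ha => ?_).trans ?_
    · refine (hp _).trans (polynomial_eval_mono p ?_)
      have := size_le_of_mem (l := l ++ l') (a := a) (by simp [ha])
      have := size_head_le st
      simp only [size]
      omega
    · have := length_le_size_ofList l
      have h3 := size_ofList_append l l'
      simp only [Polynomial.eval_add, Polynomial.eval_mul, Polynomial.eval_X, Polynomial.eval_comp,
        Polynomial.eval_ofNat, Polynomial.eval_one]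
      exact Nat.add_le_add (by omega) (Nat.mul_le_mul_right _ (by omega))
  refine (tail.comp (h.comp (cons tail (cons head nil)))).congr fun x => ?_
  have := foldl_cons_map F x.head x.tail.toList []
  simp only [Data.head, Data.tail, ofList] at this ⊢
  rw [this, List.append_nil]

theorem reverse : Comp fun x => ofList x.toList.reverse := by
  refine ((mapReverse tail).comp (cons nil id)).congr fun x => ?_
  simp [Data.tail]

/-- Mapping over the second component; the first component is a parameter. -/
theorem map {F : Data → Data} (hF : Comp F) :
    Comp fun x => ofList (x.tail.toList.map fun a => F (.cons x.head a)) :=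
  (reverse.comp (mapReverse hF)).congr fun x => by simp

theorem append : Comp fun x => ofList (x.head.toList ++ x.tail.toList) := by
  have key : ∀ (l : List Data) (st : Data),
      l.foldl (fun st a => Data.cons a st) st = ofList (l.reverse ++ st.toList) := by
    intro l
    induction l with
    | nil => simp
    | cons a l ih => simp [ih, toList]
  have h : Comp fun x => x.head.toList.foldl (fun st a => Data.cons a st) x.tail := by
    refine (foldl (G := fun x => Data.cons x.tail x.head) (cons tail head) (q := Polynomial.X)
      fun l l' st => ?_).congr fun x => rfl
    have := key l st
    simp only [Data.tail, Data.head] at this ⊢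
    rw [this, Polynomial.eval_X, size_ofList_append, size_ofList_append, size_ofList_reverse,
      ofList_toList]
    omega
  refine (h.comp (cons (reverse.comp head) tail)).congr fun x => ?_
  simp [key, Data.head, Data.tail]

/-- Blocks are prepended one after another; reversing the list of blocks beforehand restores their
order. -/
theorem flatten : Comp fun x => ofList (x.toList.map toList).flatten := by
  have key : ∀ (l : List Data) (st : Data),
      l.foldl (fun st a => ofList (a.toList ++ st.toList)) st =
        ofList ((l.reverse.map toList).flatten ++ st.toList) := by
    intro l
    induction l with
    | nil => simp
    | cons a l ih => simp [ih]
  have h : Comp fun x => x.head.toList.foldl (fun st a => ofList (a.toList ++ st.toList))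
      x.tail := by
    refine (foldl (G := fun x => ofList (x.tail.toList ++ x.head.toList))
      ((append.comp (cons tail head)).congr fun x => rfl) (q := Polynomial.X)
      fun l l' st => ?_).congr fun x => rfl
    have : ∀ st : Data, (l.foldl (fun st a => ofList (a.toList ++ st.toList)) st).size ≤
        (ofList l).size + st.size := by
      induction l with
      | nil => simp
      | cons a l ih =>
        intro st
        have := ih (ofList (a.toList ++ st.toList))
        rw [size_ofList_append, ofList_toList, ofList_toList] at this
        simp only [List.foldl_cons, ofList, size]
        omega
    have := this st
    have := size_ofList_append l l'
    simp only [Data.tail, Data.head, Polynomial.eval_X]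
    omega
  refine (h.comp (cons reverse nil)).congr fun x => ?_
  simp [key, Data.head, Data.tail, toList]

/-- The accumulator is a unary counter, started at `x`, with a list. Each round decreases the
counter and pushes it, so the list ends with `0` in front. -/
theorem range : Comp fun x => (x.toList.foldl
    (fun st _ => Data.cons st.head.tail (.cons st.head.tail st.tail)) (.cons x .nil)).tail := by
  have h : Comp fun x => x.head.toList.foldl
      (fun st _ => Data.cons st.head.tail (.cons st.head.tail st.tail)) x.tail := by
    refine (foldl (G := fun x => Data.cons x.head.head.tail (.cons x.head.head.tail x.head.tail))
      (cons (tail.comp (head.comp head)) (cons (tail.comp (head.comp head)) (tail.comp head)))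
      (q := Polynomial.X + Polynomial.X * (Polynomial.X + 2)) fun l l' st => ?_).congr fun x => rfl
    have key : ∀ (M : ℕ) (st : Data), st.head.size ≤ M → (l.foldl
        (fun st _ => Data.cons st.head.tail (.cons st.head.tail st.tail)) st).size ≤
          st.size + l.length * (M + 2) := by
      intro M
      induction l with
      | nil => simp
      | cons a l ih =>
        intro st hst
        have h1 := size_tail_le st.head
        have h2 := ih (.cons st.head.tail (.cons st.head.tail st.tail)) (h1.trans hst)
        rw [List.foldl_cons, List.length_cons, Nat.succ_mul]
        refine h2.trans ?_
        have : st.head.size + st.tail.size ≤ st.size := by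
          cases st <;> simp [Data.head, Data.tail, size]
        simp only [size]
        omega
    have h1 := key ((ofList (l ++ l')).size + st.size) st (by have := size_head_le st; omega)
    have := length_le_size_ofList l
    have h3 := size_ofList_append l l'
    simp only [Data.head, Polynomial.eval_add, Polynomial.eval_mul, Polynomial.eval_X,
      Polynomial.eval_ofNat] at h1 ⊢
    exact h1.trans (Nat.add_le_add (by omega) (Nat.mul_le_mul_right _ (by omega)))
  exact (tail.comp (h.comp (cons id (cons id nil)))).congr fun x => by
    simp [Data.head, Data.tail]

end Comp

/-! ### Polynomial-time computable functions on encoded types -/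

/-- Types with an encoding as data. -/
class Enc (α : Type) where
  enc : α → Data

open Enc

instance : Enc Data := ⟨fun d => d⟩
instance : Enc Bool := ⟨ofBool⟩
instance : Enc ℕ := ⟨ofUnary⟩
instance {α β : Type} [Enc α] [Enc β] : Enc (α × β) := ⟨fun p => .cons (enc p.1) (enc p.2)⟩
instance {α : Type} [Enc α] : Enc (List α) := ⟨fun l => ofList (l.map enc)⟩

theorem toList_ofUnary (n : ℕ) : (ofUnary n).toList = List.replicate n .nil := by
  simp [ofUnary]

/-- Polynomial-time computability of a function between encoded types. -/
def PT {α β : Type} [Enc α] [Enc β] (f : α → β) : Prop :=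
  ∃ F, Comp F ∧ ∀ a, F (enc a) = enc (f a)

namespace PT

variable {α β γ δ : Type} [Enc α] [Enc β] [Enc γ] [Enc δ]

theorem id : PT fun a : α => a := ⟨_, Comp.id, fun _ => rfl⟩

theorem comp {g : β → γ} {f : α → β} (hg : PT g) (hf : PT f) : PT fun a => g (f a) := by
  obtain ⟨F, hF, hF'⟩ := hf
  obtain ⟨G, hG, hG'⟩ := hg
  exact ⟨_, hG.comp hF, fun a => by rw [hF', hG']⟩

theorem const (b : β) : PT fun _ : α => b := ⟨_, Comp.const (enc b), fun _ => rfl⟩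

theorem fst {f : α → β × γ} (hf : PT f) : PT fun a => (f a).1 := by
  obtain ⟨F, hF, hF'⟩ := hf
  exact ⟨_, Comp.head.comp hF, fun a => by rw [hF']; rfl⟩

theorem snd {f : α → β × γ} (hf : PT f) : PT fun a => (f a).2 := by
  obtain ⟨F, hF, hF'⟩ := hf
  exact ⟨_, Comp.tail.comp hF, fun a => by rw [hF']; rfl⟩

theorem pair {f : α → β} {g : α → γ} (hf : PT f) (hg : PT g) : PT fun a => (f a, g a) := by
  obtain ⟨F, hF, hF'⟩ := hf
  obtain ⟨G, hG, hG'⟩ := hg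
  exact ⟨_, hF.cons hG, fun a => by rw [hF', hG']; rfl⟩

/-- A pair as a single datum. -/
theorem dataCons {f g : α → Data} (hf : PT f) (hg : PT g) : PT fun a => Data.cons (f a) (g a) := by
  obtain ⟨F, hF, hF'⟩ := pair hf hg
  exact ⟨F, hF, hF'⟩

theorem data {f : α → β} (hf : PT f) : PT fun a => enc (f a) := by
  obtain ⟨F, hF, hF'⟩ := hf
  exact ⟨F, hF, hF'⟩

theorem ite {c : α → Bool} {f g : α → β} (hc : PT c) (hf : PT f) (hg : PT g) :
    PT fun a => if c a = true then f a else g a := by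
  obtain ⟨C, hC, hC'⟩ := hc
  obtain ⟨F, hF, hF'⟩ := hf
  obtain ⟨G, hG, hG'⟩ := hg
  refine ⟨_, hC.cond hF hG, fun a => ?_⟩
  simp only [hC', hF', hG']
  cases c a <;> rfl

theorem congr {f g : α → β} (hf : PT f) (h : ∀ a, f a = g a) : PT g := by rwa [← funext h]

theorem not {f : α → Bool} (hf : PT f) : PT fun a => !f a :=
  congr (ite hf (const false) (const true)) fun a => by cases f a <;> rfl

theorem and {f g : α → Bool} (hf : PT f) (hg : PT g) : PT fun a => f a && g a :=
  congr (ite hf hg (const false)) fun a => by cases f a <;> rfl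

theorem or {f g : α → Bool} (hf : PT f) (hg : PT g) : PT fun a => f a || g a :=
  congr (ite hf (const true) hg) fun a => by cases f a <;> rfl

theorem map {f : α → β → γ} {l : α → List β} (hf : PT fun p : α × β => f p.1 p.2) (hl : PT l) :
    PT fun a => (l a).map (f a) := by
  obtain ⟨F, hF, hF'⟩ := hf
  obtain ⟨L, hL, hL'⟩ := hl
  refine ⟨_, (Comp.map hF).comp (Comp.id.cons hL), fun a => ?_⟩
  simp only [Data.head, Data.tail, hL']
  change ofList (((ofList ((l a).map enc)).toList).map _) = ofList (((l a).map (f a)).map enc)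
  rw [toList_ofList, List.map_map, List.map_map]
  congr 1
  exact List.map_congr_left fun b _ => hF' (a, b)

theorem flatten {l : α → List (List β)} (hl : PT l) : PT fun a => (l a).flatten := by
  obtain ⟨L, hL, hL'⟩ := hl
  refine ⟨_, Comp.flatten.comp hL, fun a => ?_⟩
  rw [hL']
  change ofList (((ofList ((l a).map fun b => ofList (b.map enc))).toList).map _).flatten =
    ofList (((l a).flatten).map enc)
  rw [toList_ofList, List.map_map, List.map_flatten]
  congr 3
  funext b
  simp

theorem flatMap {f : α → β → List γ} {l : α → List β} (hf : PT fun p : α × β => f p.1 p.2)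
    (hl : PT l) : PT fun a => (l a).flatMap (f a) :=
  congr (flatten (map hf hl)) fun _ => List.flatMap_def.symm

/-- Unary addition is concatenation. Lengths, products and roots are computed as such sums. -/
theorem sum {l : α → List ℕ} (hl : PT l) : PT fun a => (l a).sum := by
  obtain ⟨L, hL, hL'⟩ := hl
  refine ⟨_, Comp.flatten.comp hL, fun a => ?_⟩
  rw [hL']
  change ofList (((ofList ((l a).map ofUnary)).toList).map _).flatten = ofUnary (l a).sum
  rw [toList_ofList, ofUnary]
  congr 1
  induction l a with
  | nil => rfl
  | cons n l ih =>
    rw [List.map_cons, List.map_cons, List.flatten_cons, ih, List.sum_cons, List.replicate_add,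
      toList_ofUnary]

theorem length {l : α → List β} (hl : PT l) : PT fun a => (l a).length :=
  congr (sum (map (f := fun _ _ => 1) (const 1) hl)) fun a => by simp

theorem add {f g : α → ℕ} (hf : PT f) (hg : PT g) : PT fun a => f a + g a := by
  obtain ⟨F, hF, hF'⟩ := hf
  obtain ⟨G, hG, hG'⟩ := hg
  refine ⟨_, Comp.append.comp (hF.cons hG), fun a => ?_⟩
  simp only [Data.head, Data.tail, hF', hG']
  change ofList ((ofUnary _).toList ++ (ofUnary _).toList) = ofUnary _
  rw [toList_ofUnary, toList_ofUnary, ← List.replicate_add]; rfl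

theorem range {f : α → ℕ} (hf : PT f) : PT fun a => List.range (f a) := by
  obtain ⟨F, hF, hF'⟩ := hf
  refine ⟨_, Comp.range.comp hF, fun a => ?_⟩
  have key : ∀ (l : List Data) (k : List Data), (l.foldl
      (fun st _ => Data.cons st.head.tail (.cons st.head.tail st.tail))
      (.cons (ofUnary l.length) (ofList k))).tail =
        ofList ((List.range l.length).map ofUnary ++ k) := by
    intro l
    induction l with
    | nil => intro k; rfl
    | cons b l ih =>
      intro k
      rw [List.foldl_cons]
      have := ih (ofUnary l.length :: k)
      simp only [Data.head, Data.tail, ofUnary, List.length_cons, List.replicate_succ, ofList,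
        List.range_succ, List.map_append] at this ⊢
      rw [this]
      simp [ofUnary]
  have := key (ofUnary (f a)).toList []
  rw [toList_ofUnary, List.length_replicate, List.append_nil] at this
  rw [hF']
  change (((ofUnary (f a)).toList.foldl _ (Data.cons (ofUnary (f a)) _)).tail) =
    ofList ((List.range (f a)).map ofUnary)
  rw [← this, toList_ofUnary]
  rfl

theorem mul {f g : α → ℕ} (hf : PT f) (hg : PT g) : PT fun a => f a * g a :=
  congr (sum (map (f := fun a _ => g a) (hg.comp (fst id)) (range hf))) fun a => by simp

theorem pow {f : α → ℕ} (hf : PT f) : ∀ k : ℕ, PT fun a => f a ^ k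
  | 0 => const 1
  | k + 1 => mul (pow hf k) hf

theorem foldl_tail (n : ℕ) (l : List Data) :
    (List.replicate n Data.nil).foldl (fun st _ => st.tail) (ofList l) = ofList (l.drop n) := by
  induction n generalizing l with
  | zero => simp
  | succ n ih =>
    cases l with
    | nil => simpa [List.replicate_succ, ofList, Data.tail] using ih []
    | cons a l => simpa [List.replicate_succ, ofList, Data.tail] using ih l

/-- Dropping `f a` entries from the unary `g a` leaves something exactly if `f a < g a`. -/
theorem lt {f g : α → ℕ} (hf : PT f) (hg : PT g) : PT fun a => decide (f a < g a) := by
  obtain ⟨F, hF, hF'⟩ := hf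
  obtain ⟨G, hG, hG'⟩ := hg
  refine ⟨_, (Comp.drop.comp (hF.cons hG)).cond (Comp.const (ofBool true))
    (Comp.const (ofBool false)), fun a => ?_⟩
  simp only [Data.head, Data.tail, hF', hG']
  change (match (ofUnary (f a)).toList.foldl (fun st _ => st.tail) (ofUnary (g a)) with
    | .nil => ofBool false
    | .cons _ _ => ofBool true) = ofBool (decide (f a < g a))
  rw [toList_ofUnary, ofUnary, foldl_tail, List.drop_replicate]
  by_cases h : f a < g a
  · obtain ⟨k, hk⟩ := Nat.exists_eq_add_of_lt h
    rw [show g a - f a = k + 1 by omega]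
    simp [h, List.replicate_succ, ofList]
  · rw [show g a - f a = 0 by omega]
    simp [h, ofList]

theorem le {f g : α → ℕ} (hf : PT f) (hg : PT g) : PT fun a => decide (f a ≤ g a) :=
  congr (not (lt hg hf)) fun a => by simp [← decide_not]

theorem eq {f g : α → ℕ} (hf : PT f) (hg : PT g) : PT fun a => decide (f a = g a) :=
  congr (and (le hf hg) (le hg hf)) fun a => by
    rw [← Bool.decide_and]; exact decide_eq_decide.2 Nat.le_antisymm_iff.symm

/-- Past the end of the list the program reads `nil.head = nil`, so the default value has to be
encoded by `nil`. -/
theorem getD {f : α → ℕ} {l : α → List β} {b : β} (hl : PT l) (hf : PT f) (hb : enc b = .nil) :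
    PT fun a => (l a).getD (f a) b := by
  obtain ⟨F, hF, hF'⟩ := hf
  obtain ⟨L, hL, hL'⟩ := hl
  refine ⟨_, Comp.head.comp (Comp.drop.comp (hF.cons hL)), fun a => ?_⟩
  simp only [Data.head, Data.tail, hF', hL']
  change ((ofUnary (f a)).toList.foldl (fun st _ => st.tail) (ofList ((l a).map enc))).head = _
  rw [toList_ofUnary, foldl_tail, ← List.map_drop]
  rw [List.getD_eq_getElem?_getD, ← List.head?_drop]
  cases (l a).drop (f a) with
  | nil => simp [ofList, Data.head, hb]
  | cons c _ => simp [ofList, Data.head]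

end PT

/-! ### Running an algorithm on a computed input and evaluating its output -/

/-- Removes one entry of `T` for every entry different from `nil` among the first entries of `d`;
the number of inspected entries is the length of `U`. -/
def countDown : List Data → Data → Data → Data
  | [], _, T => T
  | _ :: U, d, T => match d.head with
    | .nil => countDown U d.tail T
    | .cons _ _ => countDown U d.tail T.tail

/-- The loop that computes `countDown`. -/
def countDownLoop (B : ℕ) : Prog :=
  .loop B (.seq (.tail B B) (.seq (.head (B + 2) 0)
    (.seq (.ite (B + 2) (.tail (B + 1) (B + 1)) (.clear (B + 2))) (.tail 0 0))))

theorem exec_countDownLoop {B : ℕ} (hB : 0 < B) : ∀ (U : List Data) (s : Store), s B = ofList U →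
    ∃ t s', t ≤ 10 * U.length + 1 ∧ Exec (countDownLoop B) s t s' ∧
      s' (B + 1) = countDown U (s 0) (s (B + 1))
  | [], s, hs => ⟨1, s, by simp, Exec.loop_nil hs, rfl⟩
  | a :: U, s, hs => by
    set s₁ := Function.update s B (s B).tail with hs₁
    set s₂ := Function.update s₁ (B + 2) (s₁ 0).head with hs₂
    have h0 : s₂ 0 = s 0 := by
      rw [hs₂, Function.update_of_ne (by omega), hs₁, Function.update_of_ne (by omega)]
    have h1 : s₂ (B + 1) = s (B + 1) := by simp [hs₂, hs₁]
    have h2 : s₂ (B + 2) = (s 0).head := by simp [hs₂, hs₁, hB.ne]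
    have h3 : s₂ B = ofList U := by simp [hs₂, hs₁, hs, ofList, Data.tail]
    cases hd : (s 0).head with
    | nil =>
      -- The scratch variable is `nil` already; clearing it is the idle branch of the test.
      set s₃ := Function.update s₂ (B + 2) .nil with hs₃
      obtain ⟨t, s', ht, he, hv⟩ := exec_countDownLoop hB U
        (Function.update s₃ 0 (s₃ 0).tail) (by simp [hs₃, h3, hB.ne'])
      refine ⟨_, s', ?_, Exec.loop_cons hs ((Exec.tail _ _ _).seq ((Exec.head _ _ _).seq
        ((Exec.ite_nil (h2.trans hd) (Exec.clear _ _)).seq (Exec.tail _ _ _)))) he, ?_⟩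
      · rw [List.length_cons]; omega
      · simp [hv, hs₃, countDown, hd, h0, h1]
    | cons b b' =>
      set s₃ := Function.update s₂ (B + 1) (s₂ (B + 1)).tail with hs₃
      obtain ⟨t, s', ht, he, hv⟩ := exec_countDownLoop hB U
        (Function.update s₃ 0 (s₃ 0).tail) (by simp [hs₃, h3, hB.ne'])
      refine ⟨_, s', ?_, Exec.loop_cons hs ((Exec.tail _ _ _).seq ((Exec.head _ _ _).seq
        ((Exec.ite_cons (h2.trans hd) (Exec.tail _ _ _)).seq (Exec.tail _ _ _)))) he, ?_⟩
      · rw [List.length_cons]; omega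
      · simp [hv, hs₃, countDown, hd, h0, h1]

/-- An algorithm can be run on an input computed in polynomial time, and the number of bits set in
its output can be compared with a threshold that is computed as well. -/
theorem exists_prog_countDown {c : Prog} (hc : PolyTime c) {F : Data → Data} (hF : Comp F) :
    ∃ c', PolyTime c' ∧ ∀ (x : Data) (A A' : Set Data),
      (∀ d ∈ A, countDown (F x).tail.tail.toList d (F x).tail.head ∈ A') →
      outputProb c (F x).head A ≤ outputProb c' x A' := by
  obtain ⟨B₀, hB₀⟩ := c.exists_varsBelow
  -- The summand `1` makes the input and output variable `0` lie below `B`.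
  set B := B₀ + 1
  have hB : c.VarsBelow B := hB₀.mono (by omega)
  have hB0 : 0 < B := by omega
  obtain ⟨pc, hpc⟩ := hc
  obtain ⟨p, hp, hF⟩ := hF
  obtain ⟨d, hd⟩ := hF B
  -- While `c` runs, `B` keeps the list that fixes the number of output bits to inspect, and `B + 1`
  -- keeps the threshold. Below `B` the store is exactly the initial store of `c` on `(F x).head`.
  set prep : Prog := .seq (.copy B 0) (.seq d (.seq (.head 0 B) (.seq (.tail B B)
    (.seq (.head (B + 1) B) (.tail B B))))) with hprep
  set post : Prog := .seq (countDownLoop B) (.copy 0 (B + 1)) with hpost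
  have hprep' : ∀ x : Data, ∃ t s', t ≤ p.eval x.size + 20 ∧
      Exec prep (Function.update (fun _ => Data.nil) 0 x) t s' ∧
      s' = mergeStore B s' (Function.update (fun _ => Data.nil) 0 (F x).head) ∧
      s' B = (F x).tail.tail ∧ s' (B + 1) = (F x).tail.head := by
    intro x
    set s₀ : Store := Function.update (fun _ => Data.nil) 0 x with hs₀
    obtain ⟨t, s₁, ht, he, hv, hf⟩ := hd (Function.update s₀ B (s₀ 0))
    have h0 : (Function.update s₀ B (s₀ 0)) B = x := by simp [hs₀]
    rw [h0] at ht hv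
    refine ⟨_, _, ?_, (Exec.copy _ _ _).seq (he.seq ((Exec.head _ _ _).seq ((Exec.tail _ _ _).seq
      ((Exec.head _ _ _).seq (Exec.tail _ _ _))))), ?_, ?_, ?_⟩
    · omega
    · funext i
      by_cases hi : i < B
      · rw [mergeStore_of_lt hi]
        rcases Nat.eq_zero_or_pos i with rfl | hi0
        · simp [hB0.ne, hv]
        · simp [hi.ne, hi0.ne', hf i hi, hs₀, show i ≠ B + 1 by omega]
      · rw [mergeStore_of_le (by omega)]
    · simp [hB0.ne', hv]
    · simp [hB0.ne', hv]
  have hpost' : ∀ (x : Data) (s' s : Store), s' B = (F x).tail.tail → s' (B + 1) = (F x).tail.head →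
      ∃ t s'', t ≤ 10 * p.eval x.size + 3 ∧ Exec post (mergeStore B s' s) t s'' ∧
        s'' 0 = countDown (F x).tail.tail.toList (s 0) (F x).tail.head := by
    intro x s' s h1 h2
    obtain ⟨t, s'', ht, he, hv⟩ := exec_countDownLoop hB0 (F x).tail.tail.toList (mergeStore B s' s)
      (by rw [mergeStore_of_le le_rfl, h1, ofList_toList])
    refine ⟨_, _, ?_, he.seq (Exec.copy _ _ _), ?_⟩
    · have e1 := length_le_size_ofList (F x).tail.tail.toList
      have e2 := size_tail_le (F x).tail
      have e3 := size_tail_le (F x)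
      have e4 := hp x
      rw [ofList_toList] at e1
      omega
    · rw [Function.update_self, hv, mergeStore_of_lt hB0, mergeStore_of_le (by omega), h2]
  have key : ∀ (x : Data) (A A' : Set Data),
      (∀ d ∈ A, countDown (F x).tail.tail.toList d (F x).tail.head ∈ A') → ∀ t,
      ∃ u ≤ t + (11 * p.eval x.size + 30),
        (runFor t (initConfig c (F x).head)).toOuterMeasure (haltedIn A) ≤
        (runFor u (initConfig (.seq prep (.seq c post)) x)).toOuterMeasure (haltedIn A') := by
    intro x A A' hA t
    obtain ⟨t₁, s', ht₁, he, hm, h1, h2⟩ := hprep' x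
    refine ⟨t₁ + (t + (10 * p.eval x.size + 3) + 1) + 1, by omega, ?_⟩
    rw [initConfig, initConfig, runFor, step, PMF.pure_bind, runFor_exec_add he, runFor, step,
      PMF.pure_bind, hm]
    refine runFor_embedConfig_le (K := [post]) (fun s hs u hu => ?_) t [c] _ (by simpa using hB)
    obtain ⟨t₂, s'', ht₂, he₂, hv⟩ := hpost' x s' s h1 h2
    exact he₂.toOuterMeasure_eq_one (by omega) (by rw [hv]; exact hA _ hs)
  refine ⟨.seq prep (.seq c post), ?_, fun x A A' hA => ?_⟩
  · refine ⟨pc.comp p + (11 * p + 30), fun x => polyTime_iff_toOuterMeasure.2 ?_⟩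
    -- With all outputs admitted, the comparison says that the new program surely halts because `c`
    -- does.
    obtain ⟨u, hu, hle⟩ := key x Set.univ Set.univ (by simp) (pc.eval (F x).head.size)
    rw [polyTime_iff_toOuterMeasure.1 (hpc (F x).head)] at hle
    have e1 := polynomial_eval_mono pc ((size_head_le _).trans (hp x))
    refine le_antisymm (toOuterMeasure_le_one _ _) (hle.trans (haltedIn_mono_time ?_ _))
    simp only [Polynomial.eval_add, Polynomial.eval_comp, Polynomial.eval_mul,
      Polynomial.eval_ofNat]
    omega
  · refine iSup_le fun t => ?_
    obtain ⟨u, -, hle⟩ := key x A A' hA t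
    exact hle.trans (le_iSup (fun u => (runFor u (initConfig (.seq prep (.seq c post))
      x)).toOuterMeasure (haltedIn A')) u)

/-! ### The reduction -/

/-- The integer part of the `q`-th root of `N`. -/
def natRoot (q N : ℕ) : ℕ := ((List.range N).map fun i => if (i + 1) ^ q ≤ N then 1 else 0).sum

/-- The condition `(i + 1) ^ q ≤ N` is downward closed in `i`, so the counted indices form an
initial segment and their number is the first index that fails. -/
theorem natRoot_spec {q : ℕ} (hq : q ≠ 0) (N : ℕ) :
    natRoot q N ^ q ≤ N ∧ N < (natRoot q N + 1) ^ q := by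
  have key : ∀ n, ((List.range n).map fun i => if (i + 1) ^ q ≤ N then 1 else 0).sum ≤ n ∧
      (∀ i < ((List.range n).map fun i => if (i + 1) ^ q ≤ N then 1 else 0).sum,
        (i + 1) ^ q ≤ N) ∧
      (((List.range n).map fun i => if (i + 1) ^ q ≤ N then 1 else 0).sum < n →
        N < (((List.range n).map fun i => if (i + 1) ^ q ≤ N then 1 else 0).sum + 1) ^ q) := by
    intro n
    induction n with
    | zero => simp
    | succ n ih =>
      rw [List.range_succ, List.map_append, List.sum_append]
      set S := ((List.range n).map fun i => if (i + 1) ^ q ≤ N then 1 else 0).sum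
      obtain ⟨h1, h2, h3⟩ := ih
      by_cases hn : (n + 1) ^ q ≤ N
      · have hS : S = n := by
          by_contra hS
          have := h3 (by omega)
          have := Nat.pow_le_pow_left (show S + 1 ≤ n + 1 by omega) q
          omega
        simp only [List.map_cons, hn, if_true, List.map_nil, List.sum_cons, List.sum_nil, hS]
        refine ⟨by omega, fun i hi => ?_, by omega⟩
        exact (Nat.pow_le_pow_left (show i + 1 ≤ n + 1 by omega) q).trans hn
      · simp only [List.map_cons, hn, if_false, List.map_nil, List.sum_cons, List.sum_nil, add_zero]
        refine ⟨by omega, h2, fun _ => ?_⟩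
        rcases h1.lt_or_eq with h | h
        · exact h3 h
        · rw [h]; omega
  obtain ⟨h1, h2, h3⟩ := key N
  change natRoot q N ≤ N at h1
  change ∀ i < natRoot q N, _ at h2
  change natRoot q N < N → N < (natRoot q N + 1) ^ q at h3
  constructor
  · rcases Nat.eq_zero_or_pos (natRoot q N) with h | h
    · simp [h, hq]
    · simpa [Nat.sub_add_cancel h] using h2 (natRoot q N - 1) (by omega)
  · rcases h1.lt_or_eq with h | h
    · exact h3 h
    -- If no index below `N` fails, the root equals `N`, and `N < N + 1 ≤ (N + 1) ^ q`.
    · rw [h]; exact (Nat.lt_succ_self N).trans_le (Nat.le_self_pow hq _)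

/-- The names of the sets: `(false, u, i)` is the `i`-th copy of the vertex `u`, and `(true, u, v)`
is the pair `(u, v)`. -/
def labels (N : ℕ) : List (Bool × ℕ × ℕ) :=
  [false, true].flatMap fun b => (List.range N).flatMap fun u => (List.range N).map fun v => (b, u, v)

/-- The copies of `u` and `v` precede the pair `(u, v)`; all copies precede the pairs `(u, u)`. -/
def labelPrec (x y : Bool × ℕ × ℕ) : Bool :=
  ((decide (x.2.1 = y.2.1) && decide (x.2.2 = y.2.2)) && ((x.1 && y.1) || (!x.1 && !y.1))) ||
    ((!x.1 && y.1) && (decide (y.2.1 = y.2.2) || (decide (x.2.1 = y.2.1) ||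
      decide (x.2.1 = y.2.2))))

/-- An edge `(u, v)` covers `u + v`; all pairs cover the items from `2 * N` to `4 * N - 1`, and the
pairs `(u, u)` cover everything. -/
def labelMem (adj : ℕ → ℕ → Bool) (N : ℕ) (y : Bool × ℕ × ℕ) (j : ℕ) : Bool :=
  y.1 && (decide (y.2.1 = y.2.2) || ((decide (2 * N ≤ j) && decide (j < 4 * N)) ||
    (adj y.2.1 y.2.2 && decide (j = y.2.1 + y.2.2))))

theorem labelPrec_iff (x y : Bool × ℕ × ℕ) : labelPrec x y = true ↔
    x = y ∨ (x.1 = false ∧ y.1 = true ∧ (y.2.1 = y.2.2 ∨ x.2.1 = y.2.1 ∨ x.2.1 = y.2.2)) := by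
  obtain ⟨b, u, v⟩ := x
  obtain ⟨b', u', v'⟩ := y
  cases b <;> cases b' <;> simp [labelPrec]

theorem labelMem_iff (adj : ℕ → ℕ → Bool) (N : ℕ) (y : Bool × ℕ × ℕ) (j : ℕ) :
    labelMem adj N y j = true ↔ y.1 = true ∧ (y.2.1 = y.2.2 ∨ (2 * N ≤ j ∧ j < 4 * N) ∨
      (adj y.2.1 y.2.2 = true ∧ j = y.2.1 + y.2.2)) := by
  simp [labelMem]

theorem mem_labels {N : ℕ} {x : Bool × ℕ × ℕ} : x ∈ labels N ↔ x.2.1 < N ∧ x.2.2 < N := by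
  obtain ⟨b, u, v⟩ := x
  cases b <;> simp [labels]

theorem nodup_labels (N : ℕ) : (labels N).Nodup := by
  have h : ∀ b : Bool, ((List.range N).flatMap fun u => (List.range N).map fun v =>
      (b, u, v)).Nodup := fun b => by
    rw [List.nodup_flatMap]
    refine ⟨fun u _ => List.nodup_range.map fun v v' h => by simpa using h, ?_⟩
    refine List.nodup_range.imp fun {u u'} h => ?_
    intro x hx hx'
    simp only [List.mem_map] at hx hx'
    obtain ⟨v, -, rfl⟩ := hx
    obtain ⟨v', -, h'⟩ := hx'
    simp only [Prod.mk.injEq] at h'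
    exact h h'.2.1.symm
  rw [labels, List.flatMap_cons, List.flatMap_cons, List.flatMap_nil, List.append_nil,
    List.nodup_append]
  refine ⟨h _, h _, fun x hx y hy => ?_⟩
  simp only [List.mem_flatMap, List.mem_map] at hx hy
  obtain ⟨u, -, v, -, rfl⟩ := hx
  obtain ⟨u', -, v', -, rfl⟩ := hy
  simp

theorem length_labels (N : ℕ) : (labels N).length = 2 * (N * N) := by
  simp [labels, List.length_flatMap]
  ring

/-- The instance constructed from an adjacency relation on `{0, …, N - 1}`: `r` different sums of
the endpoints of edges have to be covered. -/
def pcscInstance (N r : ℕ) (adj : ℕ → ℕ → Bool) : Instance where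
  n := 4 * N + 2 * r
  m := (labels N).length
  sets A := Finset.univ.filter fun j => labelMem adj N ((labels N).get A) j = true
  prec A B := labelPrec ((labels N).get A) ((labels N).get B) = true
  prec_refl A := (labelPrec_iff _ _).2 (Or.inl rfl)
  -- The order has height two, copies below pairs, so one of two composable relations is an
  -- equality.
  prec_trans A B C h h' := by
    rw [labelPrec_iff] at h h' ⊢
    rcases h with h | h
    · rwa [h]
    · rcases h' with h' | h'
      · rw [← h']; exact Or.inr h
      · rw [h.2.1] at h'; simp at h'
  prec_antisymm A B h h' := by
    rw [labelPrec_iff] at h h'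
    rcases h with h | h
    · exact (List.nodup_iff_injective_get.1 (nodup_labels N)) h
    · rcases h' with h' | h'
      · exact ((List.nodup_iff_injective_get.1 (nodup_labels N)) h').symm
      · rw [h.1] at h'; simp at h'
  -- Half of `4 * N + 2 * r` is `2 * N + r`: the `2 * N` items covered by every pair, and `r` more.
  f := 1 / 2
  f_pos := by norm_num
  f_le_one := by norm_num

/-- The entry of a matrix of bits. -/
def bitAt (x : List (List Bool)) (u v : ℕ) : Bool := (x.getD u []).getD v false

/-- The encoding of instances and graphs uses classical decidability; this replaces it by bits that
a program can compute. -/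
theorem ofMatrix_eq_enc {k l : ℕ} (p : Fin k → Fin l → Prop) (b : Fin k → Fin l → Bool)
    (h : ∀ i j, p i j ↔ b i j = true) :
    ofMatrix p = enc ((List.finRange k).map fun i => (List.finRange l).map (b i)) := by
  change _ = ofList (List.map _ (List.map _ _))
  rw [ofMatrix, List.map_map]
  congr 1
  refine List.map_congr_left fun i _ => ?_
  change _ = ofList (List.map _ (List.map _ _))
  rw [ofVector, List.map_map]
  congr 1
  refine List.map_congr_left fun j _ => ?_
  have : ∀ d : Decidable (p i j), @decide _ d = b i j := fun d => by
    rw [Bool.eq_iff_iff, decide_eq_true_iff, h]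
  exact congrArg ofBool (this _)

theorem map_finRange_get {α β : Type*} (l : List α) (g : α → β) :
    (List.finRange l.length).map (fun i => g (l.get i)) = l.map g := by
  conv_rhs => rw [← List.map_get_finRange l, List.map_map]
  rfl

theorem map_finRange_val {β : Type*} {n : ℕ} (g : ℕ → β) :
    (List.finRange n).map (fun i : Fin n => g i) = (List.range n).map g := by
  refine List.ext_getElem (by simp) fun i h h' => by simp

theorem encode_pcscInstance (N r : ℕ) (adj : ℕ → ℕ → Bool) : (pcscInstance N r adj).encode =
    .cons (enc (4 * N + 2 * r))
      (.cons (enc ((labels N).map fun y => (List.range (4 * N + 2 * r)).map (labelMem adj N y)))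
        (.cons (enc ((labels N).map fun x => (labels N).map (labelPrec x)))
          (.cons (ofBinary (1 / 2 : ℚ).num.toNat) (.cons (ofBinary (1 / 2 : ℚ).den) .nil)))) := by
  have h1 : (ofMatrix fun A j => j ∈ (pcscInstance N r adj).sets A) =
      enc ((labels N).map fun y => (List.range (4 * N + 2 * r)).map (labelMem adj N y)) := by
    refine (ofMatrix_eq_enc (k := (labels N).length) (l := 4 * N + 2 * r)
      (fun A j => j ∈ (pcscInstance N r adj).sets A)
      (fun A j => labelMem adj N ((labels N).get A) j)
      (fun A j => Finset.mem_filter.trans (and_iff_right (Finset.mem_univ j)))).trans (congrArg enc ?_)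
    simp only [map_finRange_val (labelMem adj N _)]
    exact map_finRange_get (labels N) fun y => (List.range (4 * N + 2 * r)).map (labelMem adj N y)
  have h2 : ofMatrix (pcscInstance N r adj).prec =
      enc ((labels N).map fun x => (labels N).map (labelPrec x)) := by
    refine (ofMatrix_eq_enc (k := (labels N).length) (l := (labels N).length) _
      (fun A B => labelPrec ((labels N).get A) ((labels N).get B))
      (fun A B => Iff.rfl)).trans (congrArg enc ?_)
    simp only [map_finRange_get (labels N) (labelPrec _)]
    exact map_finRange_get (labels N) fun x => (labels N).map (labelPrec x)
  rw [Instance.encode, h1, h2]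
  rfl

namespace PT

variable {α : Type} [Enc α]

theorem natRoot (q : ℕ) {f : α → ℕ} (hf : PT f) : PT fun a => natRoot q (f a) :=
  congr (sum (map (f := fun a i => if decide ((i + 1) ^ q ≤ f a) = true then 1 else 0)
    (ite (le (pow (add (snd id) (const 1)) q) (hf.comp (fst id))) (const 1) (const 0))
    (range hf))) fun a => by simp [PrecCover.natRoot]

theorem labels {f : α → ℕ} (hf : PT f) : PT fun a => labels (f a) :=
  flatMap (f := fun a b => (List.range (f a)).flatMap fun u => (List.range (f a)).map fun v =>
      (b, u, v))
    (flatMap (f := fun (p : α × Bool) u => (List.range (f p.1)).map fun v => (p.2, u, v))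
      (map (f := fun (p : (α × Bool) × ℕ) v => (p.1.2, p.2, v))
        (pair (snd (fst (fst id))) (pair (snd (fst id)) (snd id)))
        (range (hf.comp (fst (fst id))))) (range (hf.comp (fst id)))) (const [false, true])

theorem labelPrec {f g : α → Bool × ℕ × ℕ} (hf : PT f) (hg : PT g) :
    PT fun a => labelPrec (f a) (g a) :=
  or (and (and (eq (fst (snd hf)) (fst (snd hg))) (eq (snd (snd hf)) (snd (snd hg))))
      (or (and (fst hf) (fst hg)) (and (not (fst hf)) (not (fst hg)))))
    (and (and (not (fst hf)) (fst hg)) (or (eq (fst (snd hg)) (snd (snd hg)))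
      (or (eq (fst (snd hf)) (fst (snd hg))) (eq (fst (snd hf)) (snd (snd hg))))))

theorem bitAt {x : α → List (List Bool)} {f g : α → ℕ} (hx : PT x) (hf : PT f) (hg : PT g) :
    PT fun a => bitAt (x a) (f a) (g a) :=
  getD (getD hx hf rfl) hg rfl

theorem labelMem {x : α → List (List Bool)} {f g : α → ℕ} {y : α → Bool × ℕ × ℕ} (hx : PT x)
    (hf : PT f) (hy : PT y) (hg : PT g) :
    PT fun a => labelMem (PrecCover.bitAt (x a)) (f a) (y a) (g a) :=
  and (fst hy) (or (eq (fst (snd hy)) (snd (snd hy)))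
    (or (and (le (mul (const 2) hf) hg) (lt hg (mul (const 4) hf)))
      (and (bitAt hx (fst (snd hy)) (snd (snd hy)))
        (eq hg (add (fst (snd hy)) (snd (snd hy)))))))

theorem encode_pcscInstance {x : α → List (List Bool)} {f r : α → ℕ} (hx : PT x) (hf : PT f)
    (hr : PT r) : PT fun a => (pcscInstance (f a) (r a) (PrecCover.bitAt (x a))).encode := by
  have hn : PT fun a => 4 * f a + 2 * r a := add (mul (const 4) hf) (mul (const 2) hr)
  refine congr (dataCons (data hn) (dataCons (data (map
    (f := fun a y => (List.range (4 * f a + 2 * r a)).map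
      (PrecCover.labelMem (PrecCover.bitAt (x a)) (f a) y)) ?_ (labels hf)))
    (dataCons (data (map (f := fun a y => (PrecCover.labels (f a)).map (PrecCover.labelPrec y))
      ?_ (labels hf))) (dataCons (const (ofBinary (1 / 2 : ℚ).num.toNat))
        (dataCons (const (ofBinary (1 / 2 : ℚ).den)) (const .nil))))))
    fun a => (PrecCover.encode_pcscInstance _ _ _).symm
  · exact map (f := fun (p : α × Bool × ℕ × ℕ) j =>
        PrecCover.labelMem (PrecCover.bitAt (x p.1)) (f p.1) p.2 j)
      (labelMem (hx.comp (fst (fst id))) (hf.comp (fst (fst id))) (snd (fst id)) (snd id))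
      (range (hn.comp (fst id)))
  · exact map (f := fun (p : α × Bool × ℕ × ℕ) y => PrecCover.labelPrec p.2 y)
      (labelPrec (snd (fst id)) (snd id)) (labels (hf.comp (fst id)))

end PT

/-- Because `nil.tail = nil`, counting down truncates at zero. The result is thus `nil` exactly if
at least `T` bits are set. -/
theorem countDown_ofUnary {α : Type*} (p : α → Prop) [DecidablePred p] : ∀ (U : List Data)
    (l : List α) (T : ℕ), U.length = l.length →
    countDown U (ofList (l.map fun a => ofBool (decide (p a)))) (ofUnary T) =
      ofUnary (T - l.countP p)
  | [], [], T, _ => by simp [countDown]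
  | _ :: U, a :: l, T, h => by
    have ih := fun T => countDown_ofUnary p U l T (by simpa using h)
    by_cases ha : p a
    · have hT : (ofUnary T).tail = ofUnary (T - 1) := by
        cases T <;> simp [ofUnary, List.replicate_succ, ofList, Data.tail]
      have hd : ofBool (decide (p a)) = .cons .nil .nil := by simp [ha, ofBool]
      rw [List.map_cons, hd]
      change countDown U (ofList (l.map _)) (ofUnary T).tail = _
      rw [hT, ih, List.countP_cons_of_pos (by simpa using ha)]
      congr 1
      omega
    · have hd : ofBool (decide (p a)) = .nil := by simp [ha, ofBool]
      rw [List.map_cons, hd]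
      change countDown U (ofList (l.map _)) (ofUnary T) = _
      rw [ih, List.countP_cons_of_neg (by simpa using ha)]

theorem countP_finRange {m : ℕ} (C : Finset (Fin m)) [DecidablePred (· ∈ C)] :
    (List.finRange m).countP (· ∈ C) = C.card := by
  classical
  rw [List.countP_eq_length_filter, ← List.toFinset_card_of_nodup
    ((List.nodup_finRange m).filter _)]
  congr 1
  ext a
  simp

open Classical in
/-- The adjacency matrix as a list of rows. -/
noncomputable def adjBits {N : ℕ} (G : SimpleGraph (Fin N)) : List (List Bool) :=
  (List.finRange N).map fun u => (List.finRange N).map fun v => decide (G.Adj u v)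

theorem encodeGraph_eq_enc {N : ℕ} (G : SimpleGraph (Fin N)) :
    encodeGraph G = enc (adjBits G) :=
  ofMatrix_eq_enc _ _ fun i j => by simp

theorem bitAt_adjBits {N : ℕ} (G : SimpleGraph (Fin N)) (u v : ℕ) :
    bitAt (adjBits G) u v = true ↔ ∃ (hu : u < N) (hv : v < N), G.Adj ⟨u, hu⟩ ⟨v, hv⟩ := by
  classical
  by_cases hu : u < N
  · by_cases hv : v < N
    · simp [bitAt, adjBits, hu, hv, List.getD_eq_getElem?_getD]
    · simp [bitAt, adjBits, hu, hv, List.getD_eq_getElem?_getD]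
  · simp [bitAt, adjBits, hu, List.getD_eq_getElem?_getD]

/-- The number of items, up to the padding, that have to be covered. -/
def coverTarget (h N : ℕ) : ℕ := natRoot (6 * h) N ^ (4 * h)

/-- The number of vertices that separates the two cases. -/
def vertexThreshold (h N : ℕ) : ℕ := natRoot (6 * h) N ^ (4 * h - 1)

/-- The instance constructed from a graph. -/
noncomputable def graphInstance (h : ℕ) {N : ℕ} (G : SimpleGraph (Fin N)) : Instance :=
  pcscInstance N (coverTarget h N) (bitAt (adjBits G))

/-- From an algorithm for the cover problem one obtains an algorithm on graphs that compares the
size of the cover found with a threshold. -/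
theorem exists_prog_threshold {c : Prog} (hc : PolyTime c) (h : ℕ) :
    ∃ c', PolyTime c' ∧ ∀ {N : ℕ} (G : SimpleGraph (Fin N))
      (P : Finset (Fin (graphInstance h G).m) → Prop),
      ((∀ C, P C → N * vertexThreshold h N ≤ C.card) →
        outputProb c (graphInstance h G).encode
          {d | ∃ C, d = (graphInstance h G).encodeFamily C ∧ P C} ≤
        outputProb c' (encodeGraph G) {Data.nil}) ∧
      ((∀ C, P C → C.card < N * vertexThreshold h N) →
        outputProb c (graphInstance h G).encode
          {d | ∃ C, d = (graphInstance h G).encodeFamily C ∧ P C} ≤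
        outputProb c' (encodeGraph G) {Data.nil}ᶜ) := by
  have hN : PT fun x : List (List Bool) => x.length := PT.length PT.id
  obtain ⟨F, hF, hF'⟩ := PT.dataCons (PT.encode_pcscInstance PT.id hN
    (PT.pow (PT.natRoot (6 * h) hN) (4 * h)))
    (PT.dataCons (PT.data (PT.mul hN (PT.pow (PT.natRoot (6 * h) hN) (4 * h - 1))))
      (PT.data (PT.length (PT.labels hN))))
  obtain ⟨c', hc', hout⟩ := exists_prog_countDown hc hF
  refine ⟨c', hc', fun {N} G P => ?_⟩
  -- The program recovers the number of vertices as the number of rows.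
  have hlen : (adjBits G).length = N := by simp [adjBits]
  have hFG := hF' (adjBits G)
  rw [← encodeGraph_eq_enc] at hFG
  dsimp only at hFG
  rw [hlen] at hFG
  change F (encodeGraph G) = .cons (graphInstance h G).encode
    (.cons (ofUnary (N * vertexThreshold h N)) (ofUnary (labels N).length)) at hFG
  have key : ∀ C, countDown (F (encodeGraph G)).tail.tail.toList
      ((graphInstance h G).encodeFamily C) (F (encodeGraph G)).tail.head =
        ofUnary (N * vertexThreshold h N - C.card) := fun C => by
    classical
    rw [hFG]
    simp only [Data.head, Data.tail, toList_ofUnary, Instance.encodeFamily, ofVector]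
    rw [← countP_finRange]
    refine (@countDown_ofUnary _ (fun A => A ∈ C) (fun _ => Classical.propDecidable _) _ _ _
      ?_).trans ?_
    · simp [graphInstance, pcscInstance]
    · congr!
  have hhead : (F (encodeGraph G)).head = (graphInstance h G).encode := by rw [hFG]; rfl
  rw [← hhead]
  constructor
  · refine fun hP => hout _ _ _ ?_
    rintro _ ⟨C, rfl, hC⟩
    -- A large solution exhausts the threshold, and the output `nil` stands for the graph without
    -- planted part.
    rw [key, Nat.sub_eq_zero_of_le (hP C hC)]
    rfl
  · refine fun hP => hout _ _ _ ?_
    rintro _ ⟨C, rfl, hC⟩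
    obtain ⟨k, hk⟩ := Nat.exists_eq_add_of_lt (hP C hC)
    rw [key, hk, show C.card + k + 1 - C.card = k + 1 by omega]
    simp [ofUnary, List.replicate_succ, ofList]

/-! ### Solutions of the constructed instances -/

/-- The pairs `(a, b)` of elements of `U` with `a < b`. -/
def orderedPairs {N : ℕ} (U : Finset (Fin N)) : Finset (Fin N × Fin N) :=
  (U ×ˢ U).filter fun e => e.1 < e.2

open Classical in
/-- The edges of `G` inside `U`. -/
noncomputable def edgePairs {N : ℕ} (G : SimpleGraph (Fin N)) (U : Finset (Fin N)) :
    Finset (Fin N × Fin N) :=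
  (orderedPairs U).filter fun e => G.Adj e.1 e.2

/-- The sum of two vertices. -/
def pairSum {N : ℕ} (e : Fin N × Fin N) : ℕ := e.1 + e.2

theorem mem_edgePairs {N : ℕ} {G : SimpleGraph (Fin N)} {U : Finset (Fin N)} {e : Fin N × Fin N} :
    e ∈ edgePairs G U ↔ (e.1 ∈ U ∧ e.2 ∈ U) ∧ e.1 < e.2 ∧ G.Adj e.1 e.2 := by
  simp only [edgePairs, orderedPairs, Finset.mem_filter, Finset.mem_product, and_assoc]

theorem edgePairs_mono {N : ℕ} {G : SimpleGraph (Fin N)} {U U' : Finset (Fin N)} (h : U ⊆ U') :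
    edgePairs G U ⊆ edgePairs G U' := fun e he => by
  rw [mem_edgePairs] at he ⊢
  exact ⟨⟨h he.1.1, h he.1.2⟩, he.2⟩

variable {N r : ℕ} {G : SimpleGraph (Fin N)}

theorem pcscInstance_isSolution_iff {adj : ℕ → ℕ → Bool}
    (C : Finset (Fin (pcscInstance N r adj).m)) :
    (pcscInstance N r adj).IsSolution C ↔
      (∀ A ∈ C, ∀ B, labelPrec ((labels N).get B) ((labels N).get A) = true → B ∈ C) ∧
      2 * N + r ≤ (C.biUnion (pcscInstance N r adj).sets).card := by
  refine and_congr Iff.rfl ?_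
  have : (pcscInstance N r adj).f * (pcscInstance N r adj).n = ((2 * N + r : ℕ) : ℚ) := by
    simp only [pcscInstance]
    push_cast
    ring
  rw [this, Nat.cast_le]

theorem mem_biUnion_sets {adj : ℕ → ℕ → Bool} {C : Finset (Fin (pcscInstance N r adj).m)}
    {j : Fin (pcscInstance N r adj).n} : j ∈ C.biUnion (pcscInstance N r adj).sets ↔
      ∃ A ∈ C, labelMem adj N ((labels N).get A) j = true := by
  rw [Finset.mem_biUnion]
  exact exists_congr fun A => and_congr_right fun _ =>
    Finset.mem_filter.trans (and_iff_right (Finset.mem_univ j))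

/-- The pair `(0, 0)` alone covers all items. Without feasibility the approximation algorithm would
promise nothing on graphs that span few edges. -/
theorem pcscInstance_feasible (hN : 0 < N) (adj : ℕ → ℕ → Bool) :
    (pcscInstance N r adj).Feasible := by
  refine ⟨Finset.univ, (pcscInstance_isSolution_iff _).2 ⟨fun _ _ _ _ => Finset.mem_univ _, ?_⟩⟩
  obtain ⟨A, hA⟩ := List.mem_iff_get.1 (mem_labels.2 ⟨hN, hN⟩ :
    ((true, 0, 0) : Bool × ℕ × ℕ) ∈ labels N)
  have : Finset.univ.biUnion (pcscInstance N r adj).sets = Finset.univ := by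
    refine Finset.eq_univ_iff_forall.2 fun j => mem_biUnion_sets.2 ⟨A, Finset.mem_univ _, ?_⟩
    rw [hA, labelMem_iff]
    simp
  rw [this, Finset.card_univ, Fintype.card_fin]
  change _ ≤ 4 * N + 2 * r
  omega

/-- If few vertices span less than `r` edges, then all solutions are large. -/
theorem le_card_of_isSolution {V : ℕ} (hV : V ≤ N)
    (hG : ∀ U : Finset (Fin N), U.card ≤ V → (edgePairs G U).card < r)
    {C : Finset (Fin (pcscInstance N r (bitAt (adjBits G))).m)}
    (hC : (pcscInstance N r (bitAt (adjBits G))).IsSolution C) : N * V ≤ C.card := by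
  classical
  obtain ⟨hcl, hcov⟩ := (pcscInstance_isSolution_iff C).1 hC
  by_contra! hlt
  have hpred : ∀ A ∈ C, ∀ x ∈ labels N, labelPrec x ((labels N).get A) = true →
      ∃ B ∈ C, (labels N).get B = x := fun A hA x hx hxA => by
    obtain ⟨B, rfl⟩ := List.mem_iff_get.1 hx
    exact ⟨B, hcl A hA B hxA, rfl⟩
  -- `U` consists of the vertices all of whose `N` copies are chosen. By closure, only pairs of such
  -- vertices can belong to `C`.
  set U : Finset (Fin N) := Finset.univ.filter fun u =>
    ∀ i < N, ∃ B ∈ C, (labels N).get B = (false, (u : ℕ), i) with hU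
  have hUC : U.card * N ≤ C.card := by
    have h1 : (U ×ˢ (Finset.univ : Finset (Fin N))).image
        (fun p => (false, (p.1 : ℕ), (p.2 : ℕ))) ⊆ C.image (labels N).get := by
      intro y hy
      obtain ⟨⟨u, i⟩, hui, rfl⟩ := Finset.mem_image.1 hy
      obtain ⟨B, hB, hB'⟩ := (Finset.mem_filter.1 (Finset.mem_product.1 hui).1).2 i i.2
      exact Finset.mem_image.2 ⟨B, hB, hB'⟩
    have h2 := (Finset.card_le_card h1).trans Finset.card_image_le
    rwa [Finset.card_image_of_injective, Finset.card_product, Finset.card_univ,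
      Fintype.card_fin] at h2
    rintro ⟨u, i⟩ ⟨u', i'⟩ h
    simpa [Fin.ext_iff] using h
  have hUV : U.card < V := by
    rw [mul_comm] at hUC
    exact lt_of_mul_lt_mul_left (hUC.trans_lt hlt) (Nat.zero_le N)
  have hsub : (C.biUnion (pcscInstance N r (bitAt (adjBits G))).sets).image Fin.val ⊆
      Finset.Ico (2 * N) (4 * N) ∪ (edgePairs G U).image pairSum := by
    intro j' hj'
    obtain ⟨j, hj, rfl⟩ := Finset.mem_image.1 hj'
    obtain ⟨A, hA, hAj⟩ := mem_biUnion_sets.1 hj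
    obtain ⟨hu, hv⟩ := mem_labels.1 (List.get_mem (labels N) A)
    have hpA := hpred A hA
    rw [labelMem_iff] at hAj
    obtain ⟨ht, hAj⟩ := hAj
    set y := (labels N).get A
    rcases hAj with hd | hf | ⟨hadj, hsum⟩
    -- A pair `(u, u)` requires every copy, which contradicts `U.card < V ≤ N`.
    · have : U = Finset.univ := Finset.eq_univ_iff_forall.2 fun u => by
        refine Finset.mem_filter.2 ⟨Finset.mem_univ _, fun i hi => ?_⟩
        exact hpA _ (mem_labels.2 ⟨u.2, hi⟩) ((labelPrec_iff _ _).2 (Or.inr ⟨rfl, ht, Or.inl hd⟩))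
      rw [this, Finset.card_univ, Fintype.card_fin] at hUV
      omega
    · exact Finset.mem_union_left _ (Finset.mem_Ico.2 hf)
    · obtain ⟨hu', hv', hadj⟩ := (bitAt_adjBits G _ _).1 hadj
      have huU : (⟨y.2.1, hu'⟩ : Fin N) ∈ U := Finset.mem_filter.2 ⟨Finset.mem_univ _, fun i hi =>
        hpA _ (mem_labels.2 ⟨hu, hi⟩)
          ((labelPrec_iff _ _).2 (Or.inr ⟨rfl, ht, Or.inr (Or.inl rfl)⟩))⟩
      have hvU : (⟨y.2.2, hv'⟩ : Fin N) ∈ U := Finset.mem_filter.2 ⟨Finset.mem_univ _, fun i hi =>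
        hpA _ (mem_labels.2 ⟨hv, hi⟩)
          ((labelPrec_iff _ _).2 (Or.inr ⟨rfl, ht, Or.inr (Or.inr rfl)⟩))⟩
      refine Finset.mem_union_right _ (Finset.mem_image.2 ?_)
      rcases lt_or_gt_of_ne hadj.ne with h | h
      · exact ⟨(_, _), mem_edgePairs.2 ⟨⟨huU, hvU⟩, h, hadj⟩, hsum.symm⟩
      · exact ⟨(_, _), mem_edgePairs.2 ⟨⟨hvU, huU⟩, h, hadj.symm⟩, by
          rw [hsum, pairSum, add_comm]⟩
  have h1 := Finset.card_le_card hsub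
  rw [Finset.card_image_of_injective _ Fin.val_injective] at h1
  have h2 := Finset.card_union_le (Finset.Ico (2 * N) (4 * N)) ((edgePairs G U).image pairSum)
  have h3 : ((edgePairs G U).image pairSum).card ≤ (edgePairs G U).card := Finset.card_image_le
  have h4 := hG U hUV.le
  rw [Nat.card_Ico] at h2
  omega

/-- A set of vertices that spans edges with `r` different sums yields a small solution. -/
theorem exists_isSolution (hr : 0 < r) {S : Finset (Fin N)}
    (hS : r ≤ ((edgePairs G S).image pairSum).card) :
    ∃ C, (pcscInstance N r (bitAt (adjBits G))).IsSolution C ∧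
      C.card ≤ S.card * N + S.card * S.card := by
  classical
  -- All copies of the vertices of `S` and all pairs of different vertices of `S` are chosen,
  -- whether edges or not. Pairs `(u, u)` are left out, since they would force all copies.
  set Q : Bool × ℕ × ℕ → Prop := fun y => (∃ u ∈ S, (u : ℕ) = y.2.1) ∧
    (y.1 = true → y.2.1 ≠ y.2.2 ∧ ∃ v ∈ S, (v : ℕ) = y.2.2) with hQ
  set C : Finset (Fin (labels N).length) := Finset.univ.filter fun A => Q ((labels N).get A) with hC
  have hmem : ∀ A, A ∈ C ↔ Q ((labels N).get A) := fun A => by simp [hC]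
  have hlab : ∀ e ∈ edgePairs G S, ∃ A ∈ C, (labels N).get A = (true, (e.1 : ℕ), (e.2 : ℕ)) := by
    intro e he
    obtain ⟨⟨h1, h2⟩, h3, -⟩ := mem_edgePairs.1 he
    obtain ⟨A, hA⟩ := List.mem_iff_get.1 (mem_labels.2 ⟨e.1.2, e.2.2⟩ :
      ((true, (e.1 : ℕ), (e.2 : ℕ)) : Bool × ℕ × ℕ) ∈ labels N)
    refine ⟨A, (hmem A).2 ?_, hA⟩
    rw [hA]
    exact ⟨⟨_, h1, rfl⟩, fun _ => ⟨Nat.ne_of_lt h3, _, h2, rfl⟩⟩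
  refine ⟨C, (pcscInstance_isSolution_iff (adj := bitAt (adjBits G)) (r := r) C).2 ⟨?_, ?_⟩, ?_⟩
  · intro A hA B hBA
    replace hA := (hmem A).1 hA
    refine (hmem B).2 (?_ : Q _)
    rw [labelPrec_iff] at hBA
    rcases hBA with h | ⟨h1, h2, h3⟩
    · rw [h]; exact hA
    · obtain ⟨hA1, hA2⟩ := hA
      obtain ⟨hne, hA2⟩ := hA2 h2
      refine ⟨?_, fun h => by rw [h1] at h; simp at h⟩
      rcases h3 with h3 | h3 | h3
      · exact absurd h3 hne
      · rwa [h3]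
      · rwa [h3]
  · have hsub : Finset.Ico (2 * N) (4 * N) ∪ (edgePairs G S).image pairSum ⊆
        (C.biUnion (pcscInstance N r (bitAt (adjBits G))).sets).image Fin.val := by
      have hn : (pcscInstance N r (bitAt (adjBits G))).n = 4 * N + 2 * r := rfl
      intro j hj
      rcases Finset.mem_union.1 hj with hj | hj
      · have hj := Finset.mem_Ico.1 hj
        -- As `r > 0`, some edge lies in `S`, and its pair already covers the whole padding.
        obtain ⟨x, hx⟩ := Finset.card_pos.1 (hr.trans_le hS)
        obtain ⟨e, he, -⟩ := Finset.mem_image.1 hx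
        obtain ⟨A, hA, hAe⟩ := hlab e he
        refine Finset.mem_image.2 ⟨⟨j, by omega⟩, mem_biUnion_sets.2 ⟨A, hA, ?_⟩, rfl⟩
        rw [hAe, labelMem_iff]
        exact ⟨rfl, Or.inr (Or.inl hj)⟩
      · obtain ⟨e, he, rfl⟩ := Finset.mem_image.1 hj
        obtain ⟨A, hA, hAe⟩ := hlab e he
        have h1 := e.1.2
        have h2 := e.2.2
        refine Finset.mem_image.2 ⟨⟨pairSum e, by rw [hn, pairSum]; omega⟩,
          mem_biUnion_sets.2 ⟨A, hA, ?_⟩, rfl⟩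
        rw [hAe, labelMem_iff]
        exact ⟨rfl, Or.inr (Or.inr ⟨(bitAt_adjBits G _ _).2
          ⟨h1, h2, (mem_edgePairs.1 he).2.2⟩, rfl⟩)⟩
    have h1 := Finset.card_le_card hsub
    rw [Finset.card_image_of_injective _ Fin.val_injective, Finset.card_union_of_disjoint,
      Nat.card_Ico] at h1
    · have h2 : 2 * N + r ≤ 4 * N - 2 * N + ((edgePairs G S).image pairSum).card := by omega
      exact (h2.trans h1).trans_eq (by congr!)
    · rw [Finset.disjoint_left]
      intro j hj hj'
      obtain ⟨e, -, rfl⟩ := Finset.mem_image.1 hj'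
      have h1 := e.1.2
      have h2 := e.2.2
      have := (Finset.mem_Ico.1 hj).1
      rw [pairSum] at this
      omega
  · have hsub : C.image (labels N).get ⊆
        (S ×ˢ (Finset.univ : Finset (Fin N))).image (fun p => (false, (p.1 : ℕ), (p.2 : ℕ))) ∪
        (S ×ˢ S).image (fun p => (true, (p.1 : ℕ), (p.2 : ℕ))) := by
      intro y hy
      obtain ⟨A, hA, rfl⟩ := Finset.mem_image.1 hy
      have hA := (hmem A).1 hA
      obtain ⟨-, hv⟩ := mem_labels.1 (List.get_mem (labels N) A)
      generalize (labels N).get A = y at *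
      obtain ⟨b, u', v'⟩ := y
      obtain ⟨⟨u, huS, rfl⟩, h2⟩ := hA
      cases b with
      | false =>
        exact Finset.mem_union_left _ (Finset.mem_image.2
          ⟨(u, ⟨v', hv⟩), Finset.mem_product.2 ⟨huS, Finset.mem_univ _⟩, rfl⟩)
      | true =>
        obtain ⟨-, v, hvS, rfl⟩ := h2 rfl
        exact Finset.mem_union_right _ (Finset.mem_image.2
          ⟨(u, v), Finset.mem_product.2 ⟨huS, hvS⟩, rfl⟩)
    have h1 := (Finset.card_le_card hsub).trans (Finset.card_union_le _ _)
    rw [Finset.card_image_of_injective _ (List.nodup_iff_injective_get.1 (nodup_labels N))] at h1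
    refine h1.trans (Nat.add_le_add (Finset.card_image_le.trans ?_)
      (Finset.card_image_le.trans ?_))
    · simp
    · simp

/-! ### Counting successes of independent trials -/

section Trials

variable {Ω ι : Type*} {A : ι → Set Ω} {I : Finset ι}

open Classical in
/-- The number of events with index in `I` that occur. -/
noncomputable def occurrences (A : ι → Set Ω) (I : Finset ι) (ω : Ω) : ℕ :=
  (I.filter fun i => ω ∈ A i).card

/-- Both sides count the sets of events that all occur. Taking expectations turns the right-hand
side into `∑ p ^ F.card = (1 + p) ^ I.card`. -/
theorem two_pow_occurrences (ω : Ω) : (2 : ℝ) ^ occurrences A I ω =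
    ∑ F ∈ I.powerset, {ω | ∀ i ∈ F, ω ∈ A i}.indicator 1 ω := by
  classical
  have : I.powerset.filter (fun F => ∀ i ∈ F, ω ∈ A i) =
      (I.filter fun i => ω ∈ A i).powerset := by
    ext F
    simp only [Finset.mem_filter, Finset.mem_powerset, Finset.subset_iff]
    exact ⟨fun h i hi => ⟨h.1 hi, h.2 i hi⟩, fun h => ⟨fun i hi => (h hi).1, fun i hi => (h hi).2⟩⟩
  simp only [Set.indicator_apply, Set.mem_ofPred_eq, Pi.one_apply]
  rw [Finset.sum_boole, this, Finset.card_powerset, occurrences]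
  norm_cast

theorem occurrences_eq_sum (ω : Ω) : (occurrences A I ω : ℝ) =
    ∑ i ∈ I, (A i).indicator 1 ω := by
  classical
  simp only [Set.indicator_apply, Pi.one_apply]
  rw [Finset.sum_boole]
  rfl

variable [Finite Ω] [MeasurableSpace Ω] [MeasurableSingletonClass Ω] {μ : Measure Ω}
  [IsProbabilityMeasure μ] {p : ℝ}

theorem integral_sum_indicator {κ : Type*} (J : Finset κ) (B : κ → Set Ω) :
    ∫ ω, ∑ j ∈ J, (B j).indicator (1 : Ω → ℝ) ω ∂μ = ∑ j ∈ J, μ.real (B j) := by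
  rw [integral_finsetSum _ fun _ _ => Integrable.of_finite]
  exact Finset.sum_congr rfl fun j _ => integral_indicator_one (Set.toFinite _).measurableSet

/-- Upper tail of the number of occurring events. -/
theorem measureReal_le_occurrences (hA : ∀ F ⊆ I, μ.real {ω | ∀ i ∈ F, ω ∈ A i} = p ^ F.card)
    (r : ℕ) : μ.real {ω | r ≤ occurrences A I ω} ≤ (1 + p) ^ I.card / 2 ^ r := by
  -- Markov's inequality for `2 ^ X` at the level `2 ^ r`, where `X` is the number of occurring
  -- events.
  have h1 := mul_meas_ge_le_integral_of_nonneg (μ := μ) (f := fun ω => (2 : ℝ) ^ occurrences A I ω)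
    (Eventually.of_forall fun ω => by positivity) Integrable.of_finite (2 ^ r)
  simp only [two_pow_occurrences (A := A) (I := I)] at h1
  rw [integral_sum_indicator, Finset.sum_congr rfl fun F hF => hA F (Finset.mem_powerset.1 hF)] at h1
  have h2 := Finset.sum_pow_mul_eq_add_pow p 1 I
  simp only [one_pow, mul_one] at h2
  rw [h2] at h1
  rw [le_div_iff₀ (by positivity), mul_comm, add_comm 1 p]
  refine le_trans (le_of_eq ?_) h1
  congr 2
  ext ω
  rw [Set.mem_ofPred_eq, Set.mem_ofPred_eq, ← two_pow_occurrences]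
  exact (pow_le_pow_iff_right₀ (by norm_num)).symm

/-- Lower tail of the number of occurring events. -/
theorem measureReal_occurrences_le (hA : ∀ F ⊆ I, μ.real {ω | ∀ i ∈ F, ω ∈ A i} = p ^ F.card)
    (hp : 0 < p) (hI : 0 < I.card) :
    μ.real {ω | (occurrences A I ω : ℝ) ≤ I.card * p / 2} ≤ 4 / (I.card * p) := by
  classical
  have hA1 : ∀ i ∈ I, μ.real (A i) = p := fun i hi => by
    simpa using hA {i} (by simpa using hi)
  have hE : ∫ ω, (occurrences A I ω : ℝ) ∂μ = I.card * p := by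
    simp only [occurrences_eq_sum]
    rw [integral_sum_indicator, Finset.sum_congr rfl hA1]
    simp
  have hE2 : ∫ ω, ((fun ω => (occurrences A I ω : ℝ)) ^ 2) ω ∂μ ≤
      (I.card * p) ^ 2 + I.card * p := by
    have : ∀ ω, ((fun ω => (occurrences A I ω : ℝ)) ^ 2) ω =
        ∑ x ∈ I ×ˢ I, (A x.1 ∩ A x.2).indicator 1 ω := fun ω => by
      rw [Pi.pow_apply, occurrences_eq_sum, sq, Finset.sum_mul_sum, Finset.sum_product]
      refine Finset.sum_congr rfl fun i _ => Finset.sum_congr rfl fun j _ => ?_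
      rw [← Pi.mul_apply, ← Set.inter_indicator_one]
    simp only [this]
    rw [integral_sum_indicator, Finset.sum_product]
    -- In the second moment the diagonal term is `p` and the others are `p ^ 2`; consequently the
    -- variance is at most the mean.
    have hle : ∀ i ∈ I, ∑ j ∈ I, μ.real (A i ∩ A j) ≤ I.card * p ^ 2 + p := fun i hi => by
      rw [← Finset.sum_erase_add _ _ hi, Set.inter_self, hA1 i hi]
      gcongr
      have : ∀ j ∈ I.erase i, μ.real (A i ∩ A j) = p ^ 2 := fun j hj => by
        obtain ⟨hji, hj⟩ := Finset.mem_erase.1 hj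
        have := hA {i, j} (by simp [Finset.insert_subset_iff, hi, hj])
        rw [Finset.card_pair hji.symm] at this
        rw [← this]
        congr 1
        ext ω
        simp
      rw [Finset.sum_congr rfl this, Finset.sum_const, nsmul_eq_mul]
      gcongr
      exact Finset.erase_subset _ _
    refine (Finset.sum_le_sum hle).trans (le_of_eq ?_)
    rw [Finset.sum_const, nsmul_eq_mul]
    ring
  have hmem : MemLp (fun ω => (occurrences A I ω : ℝ)) 2 μ := by
    have : DiscreteMeasurableSpace Ω := inferInstance
    exact MemLp.of_discrete
  have hvar : Var[fun ω => (occurrences A I ω : ℝ); μ] ≤ I.card * p := by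
    rw [variance_eq_sub hmem, hE]
    linarith
  have hpos : (0 : ℝ) < I.card * p := by positivity
  -- Chebyshev's inequality for a deviation of half the mean; squaring the half gives the factor
  -- `4`.
  have hcheb := meas_ge_le_variance_div_sq hmem (c := I.card * p / 2) (by positivity)
  rw [hE] at hcheb
  have h1 : μ.real {ω | (occurrences A I ω : ℝ) ≤ I.card * p / 2} ≤
      μ.real {ω | I.card * p / 2 ≤ |(occurrences A I ω : ℝ) - I.card * p|} := by
    refine measureReal_mono fun ω hω => ?_
    simp only [Set.mem_ofPred_eq] at hω ⊢
    rw [abs_sub_comm]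
    exact (by linarith : _ ≤ I.card * p - (occurrences A I ω : ℝ)).trans (le_abs_self _)
  have h2 : μ.real {ω | I.card * p / 2 ≤ |(occurrences A I ω : ℝ) - I.card * p|} ≤
      Var[fun ω => (occurrences A I ω : ℝ); μ] / (I.card * p / 2) ^ 2 := by
    exact ENNReal.toReal_le_of_le_ofReal (div_nonneg (variance_nonneg _ _) (sq_nonneg _)) hcheb
  refine h1.trans (h2.trans ?_)
  rw [div_le_div_iff₀ (by positivity) hpos]
  nlinarith

/-- Markov's inequality for the number of occurring events. -/
theorem measureReal_le_occurrences_of_measureReal_eq {κ : Type*} (J : Finset κ) (B : κ → Set Ω) {q : ℝ}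
    (hB : ∀ j ∈ J, μ.real (B j) = q) {r : ℕ} (hr : 0 < r) :
    μ.real {ω | r ≤ occurrences B J ω} ≤ J.card * q / r := by
  have h1 := mul_meas_ge_le_integral_of_nonneg (μ := μ) (f := fun ω => (occurrences B J ω : ℝ))
    (Eventually.of_forall fun ω => by positivity) Integrable.of_finite r
  have hE : ∫ ω, (occurrences B J ω : ℝ) ∂μ = J.card * q := by
    simp only [occurrences_eq_sum]
    rw [integral_sum_indicator, Finset.sum_congr rfl hB]
    simp
  rw [hE] at h1
  rw [le_div_iff₀ (by positivity), mul_comm]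
  simpa using h1

end Trials

/-! ### Binomial random graphs -/

/-- On a finite space with measurable points every event is measurable and every function
integrable. -/
instance (N : ℕ) : MeasurableSingletonClass (SimpleGraph (Fin N)) where
  measurableSet_singleton G := by
    rw [← SimpleGraph.measurableEmbedding_edgeSet.measurableSet_image, Set.image_singleton]
    exact measurableSet_singleton _

/-- Increasing pairs name different non-loop edges, which are independent. This is the product
formula that the tail bounds above take as their hypothesis. -/
theorem binomialRandom_forall_adj {N : ℕ} (p : unitInterval) {F : Finset (Fin N × Fin N)}
    (hF : F ⊆ orderedPairs Finset.univ) :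
    (SimpleGraph.binomialRandom (Fin N) p).real {G | ∀ e ∈ F, G.Adj e.1 e.2} =
      (p : ℝ) ^ F.card := by
  classical
  have hlt : ∀ e ∈ F, e.1 < e.2 := fun e he => (Finset.mem_filter.1 (hF he)).2
  set F' : Finset (Sym2 (Fin N)) := F.image fun e => s(e.1, e.2) with hF'
  have hcard : F'.card = F.card := by
    refine Finset.card_image_of_injOn fun e he e' he' h => ?_
    have h1 := hlt e he
    have h2 := hlt e' he'
    rcases Sym2.eq_iff.1 h with h | h
    · exact Prod.ext h.1 h.2
    · rw [h.1, h.2] at h1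
      exact absurd h1 h2.asymm
  have hset : ({G | ∀ e ∈ F, G.Adj e.1 e.2} : Set (SimpleGraph (Fin N))) =
      SimpleGraph.edgeSet ⁻¹' {s | ∀ e ∈ F', e ∈ s} := by
    ext G
    simp only [hF', Finset.mem_image, Set.mem_preimage, Set.mem_ofPred_eq]
    exact ⟨fun h e ⟨e', he', h'⟩ => h' ▸ h e' he', fun h e he => h _ ⟨e, he, rfl⟩⟩
  have hmeas : MeasurableSet ({s | ∀ e ∈ F', e ∈ s} : Set (Set (Sym2 (Fin N)))) :=
    (Set.toFinite _).measurableSet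
  rw [hset, measureReal_def, SimpleGraph.binomialRandom_eq_map,
    Measure.map_apply SimpleGraph.measurable_fromEdgeSet
      (SimpleGraph.measurable_edgeSet hmeas), ← Set.preimage_comp]
  -- Passing from a set of edges to a graph discards only loops, and `F'` contains none.
  have hset2 : (SimpleGraph.edgeSet ∘ SimpleGraph.fromEdgeSet (V := Fin N)) ⁻¹'
      {s | ∀ e ∈ F', e ∈ s} = {s | ∀ e ∈ F', e ∈ s} := by
    ext s
    simp only [Set.mem_preimage, Function.comp_apply, SimpleGraph.edgeSet_fromEdgeSet,
      Set.mem_ofPred_eq]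
    refine forall₂_congr fun e he => ⟨fun h => h.1, fun h => ⟨h, ?_⟩⟩
    obtain ⟨e', he', rfl⟩ := Finset.mem_image.1 he
    simpa using (hlt e' he').ne
  rw [hset2, setBernoulli_apply']
  have hpi : (fun p : Sym2 (Fin N) → Prop => {i | p i}) ⁻¹' {s | ∀ e ∈ F', e ∈ s} =
      (F' : Set (Sym2 (Fin N))).pi fun _ => {True} := by
    ext s
    simp [Set.mem_pi]
  have key : ∀ e ∈ F', ((unitInterval.toNNReal p • Measure.dirac (e ∈ (Sym2.diagSetᶜ :
      Set (Sym2 (Fin N)))) + unitInterval.toNNReal (unitInterval.symm p) • Measure.dirac False :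
        Measure Prop) {True}) = unitInterval.toNNReal p := by
    intro e he
    obtain ⟨e', he', rfl⟩ := Finset.mem_image.1 he
    have : (s(e'.1, e'.2) ∈ (Sym2.diagSetᶜ : Set (Sym2 (Fin N)))) = True := by
      simpa using (hlt e' he').ne
    rw [this]
    simp
  rw [hpi, Measure.infinitePi_pi _ fun _ _ => MeasurableSet.of_discrete,
    Finset.prod_congr rfl key, Finset.prod_const, hcard]
  simp

/-! ### The two random graphs -/

theorem card_orderedPairs_le {N : ℕ} (U : Finset (Fin N)) : (orderedPairs U).card ≤ U.card ^ 2 :=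
  (Finset.card_filter_le _ _).trans (by rw [Finset.card_product, sq])

theorem two_mul_card_orderedPairs {N : ℕ} (U : Finset (Fin N)) :
    2 * (orderedPairs U).card = U.card * U.card - U.card := by
  have h1 : U.offDiag = orderedPairs U ∪ (orderedPairs U).map (Equiv.prodComm _ _).toEmbedding := by
    ext ⟨a, b⟩
    simp only [Finset.mem_offDiag, orderedPairs, Finset.mem_union, Finset.mem_filter,
      Finset.mem_product, Finset.mem_map_equiv, Equiv.prodComm_symm, Equiv.prodComm_apply,
      Prod.swap_prod_mk]
    constructor
    · rintro ⟨ha, hb, h⟩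
      rcases lt_or_gt_of_ne h with h | h
      · exact Or.inl ⟨⟨ha, hb⟩, h⟩
      · exact Or.inr ⟨⟨hb, ha⟩, h⟩
    · rintro (⟨⟨ha, hb⟩, h⟩ | ⟨⟨hb, ha⟩, h⟩)
      · exact ⟨ha, hb, h.ne⟩
      · exact ⟨ha, hb, h.ne'⟩
  have h2 : Disjoint (orderedPairs U) ((orderedPairs U).map (Equiv.prodComm _ _).toEmbedding) := by
    rw [Finset.disjoint_left]
    rintro ⟨a, b⟩ h h'
    simp only [orderedPairs, Finset.mem_filter, Finset.mem_map_equiv, Equiv.prodComm_symm,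
      Equiv.prodComm_apply, Prod.swap_prod_mk] at h h'
    exact h.2.asymm h'.2
  rw [← Finset.offDiag_card, h1, Finset.card_union_of_disjoint h2, Finset.card_map, two_mul]

theorem orderedPairs_mono {N : ℕ} {U U' : Finset (Fin N)} (h : U ⊆ U') :
    orderedPairs U ⊆ orderedPairs U' :=
  Finset.filter_subset_filter _ (Finset.product_subset_product h h)

/-- The event that a pair is an edge. -/
def edgeEvent {N : ℕ} (e : Fin N × Fin N) : Set (SimpleGraph (Fin N)) := {G | G.Adj e.1 e.2}

theorem occurrences_edgeEvent {N : ℕ} (U : Finset (Fin N)) (G : SimpleGraph (Fin N)) :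
    occurrences edgeEvent (orderedPairs U) G = (edgePairs G U).card := by
  rw [occurrences, edgePairs]
  congr!

theorem measureReal_forall_edgeEvent {N : ℕ} (p : unitInterval) (U : Finset (Fin N)) :
    ∀ F ⊆ orderedPairs U, (SimpleGraph.binomialRandom (Fin N) p).real
      {G | ∀ e ∈ F, G ∈ edgeEvent e} = (p : ℝ) ^ F.card :=
  fun _ hF => binomialRandom_forall_adj p (hF.trans (orderedPairs_mono (Finset.subset_univ U)))

/-- In a binomial random graph few vertices are unlikely to span many edges. -/
theorem measureReal_exists_edgePairs_le {N V : ℕ} (hV : V ≤ N) (p : unitInterval) (r : ℕ) :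
    (SimpleGraph.binomialRandom (Fin N) p).real
      {G | ∃ U : Finset (Fin N), U.card ≤ V ∧ r ≤ (edgePairs G U).card} ≤
        (N : ℝ) ^ V * ((1 + p) ^ V ^ 2 / 2 ^ r) := by
  have hp : 0 ≤ (p : ℝ) := p.2.1
  have hsub : {G : SimpleGraph (Fin N) | ∃ U : Finset (Fin N), U.card ≤ V ∧
      r ≤ (edgePairs G U).card} ⊆ ⋃ U ∈ Finset.powersetCard V (Finset.univ : Finset (Fin N)),
        {G | r ≤ occurrences edgeEvent (orderedPairs U) G} := by
    rintro G ⟨U, hU, hr⟩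
    -- Enlarging `U` to exactly `V` vertices loses no edges, so the union bound needs only the
    -- `V`-subsets.
    obtain ⟨U', hUU', hU'⟩ := Finset.exists_superset_card_eq hU (by simpa using hV)
    refine Set.mem_biUnion (Finset.mem_coe.2 (Finset.mem_powersetCard.2
      ⟨Finset.subset_univ _, hU'⟩)) ?_
    rw [Set.mem_ofPred_eq, occurrences_edgeEvent]
    exact hr.trans (Finset.card_le_card (edgePairs_mono hUU'))
  refine (measureReal_mono hsub (measure_ne_top _ _)).trans ((measureReal_biUnion_finset_le _ _).trans ?_)
  have hle : ∀ U ∈ Finset.powersetCard V (Finset.univ : Finset (Fin N)),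
      (SimpleGraph.binomialRandom (Fin N) p).real
        {G | r ≤ occurrences edgeEvent (orderedPairs U) G} ≤ (1 + p) ^ V ^ 2 / 2 ^ r := by
    intro U hU
    refine (measureReal_le_occurrences (measureReal_forall_edgeEvent p U) r).trans ?_
    have := card_orderedPairs_le U
    rw [(Finset.mem_powersetCard.1 hU).2] at this
    gcongr
    linarith
  refine (Finset.sum_le_card_nsmul _ _ _ hle).trans ?_
  rw [Finset.card_powersetCard, Finset.card_univ, Fintype.card_fin, nsmul_eq_mul]
  gcongr
  exact_mod_cast Nat.choose_le_pow N V

/-- Pairs of different pairs with the same sum. -/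
def collisions {N : ℕ} (S : Finset (Fin N)) : Finset ((Fin N × Fin N) × (Fin N × Fin N)) :=
  (orderedPairs S ×ˢ orderedPairs S).filter fun x => x.1 ≠ x.2 ∧ pairSum x.1 = pairSum x.2

/-- In each fibre of `g`, one element is paid for by the image, and every other element by its pair
with the first. -/
theorem card_le_card_image_add {α β : Type*} [DecidableEq α] [DecidableEq β] (E : Finset α)
    (g : α → β) : E.card ≤ (E.image g).card +
      ((E ×ˢ E).filter fun x => x.1 ≠ x.2 ∧ g x.1 = g x.2).card := by
  have h1 : E.card = ∑ b ∈ E.image g, (E.filter fun a => g a = b).card :=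
    Finset.card_eq_sum_card_image g E
  have h2 : ((E ×ˢ E).filter fun x => x.1 ≠ x.2 ∧ g x.1 = g x.2).card =
      ∑ b ∈ E.image g, (((E ×ˢ E).filter fun x => x.1 ≠ x.2 ∧ g x.1 = g x.2).filter
        fun x => g x.1 = b).card :=
    Finset.card_eq_sum_card_fiberwise fun x hx => Finset.mem_coe.2 (Finset.mem_image_of_mem g
      (Finset.mem_product.1 (Finset.mem_filter.1 hx).1).1)
  rw [h2, Finset.card_eq_sum_ones (E.image g), ← Finset.sum_add_distrib, h1]
  refine Finset.sum_le_sum fun b hb => ?_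
  obtain ⟨a, ha, rfl⟩ := Finset.mem_image.1 hb
  have h3 : ((E.filter fun a' => g a' = g a).erase a).card ≤
      (((E ×ˢ E).filter fun x => x.1 ≠ x.2 ∧ g x.1 = g x.2).filter fun x => g x.1 = g a).card := by
    refine Finset.card_le_card_of_injOn (fun a' => (a', a)) (fun a' ha' => ?_)
      fun _ _ _ _ h => congrArg Prod.fst h
    have ha' := Finset.mem_erase.1 (Finset.mem_coe.1 ha')
    have ha'' := Finset.mem_filter.1 ha'.2
    simp only [Finset.coe_filter, Finset.mem_product, Set.mem_ofPred_eq, Finset.mem_filter]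
    exact ⟨⟨⟨ha''.1, ha⟩, ha'.1, ha''.2⟩, ha''.2⟩
  rw [Finset.card_erase_of_mem (show a ∈ E.filter fun a' => g a' = g a from
    Finset.mem_filter.2 ⟨ha, rfl⟩)] at h3
  omega

/-- The first pair and one vertex of the second determine the remaining vertex through the common
sum. -/
theorem card_collisions_univ_le (N : ℕ) :
    (collisions (Finset.univ : Finset (Fin N))).card ≤ N ^ 3 := by
  have : (collisions (Finset.univ : Finset (Fin N))).card ≤
      (Finset.univ : Finset ((Fin N × Fin N) × Fin N)).card := by
    refine Finset.card_le_card_of_injOn (fun x => (x.1, x.2.1)) (fun _ _ => by simp) ?_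
    rintro ⟨e, a, b⟩ hx ⟨e', a', b'⟩ hx' h
    simp only [Prod.mk.injEq] at h
    obtain ⟨rfl, rfl⟩ := h
    have h1 := (Finset.mem_filter.1 hx).2.2
    have h2 := (Finset.mem_filter.1 hx').2.2
    simp only [pairSum] at h1 h2
    have : b = b' := Fin.ext (by omega)
    rw [this]
  refine this.trans (le_of_eq ?_)
  simp
  ring

/-- A random `k`-set contains `i` given vertices with probability at most `(k / N) ^ i`. Each step
of the induction uses `(k - i) / (N - i) ≤ k / N`, which is `h2` below. -/
theorem choose_sub_mul_pow_le {N k : ℕ} (hk : k ≤ N) : ∀ i ≤ k,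
    (N - i).choose (k - i) * N ^ i ≤ k ^ i * N.choose k
  | 0, _ => by simp
  | i + 1, hi => by
    have ih := choose_sub_mul_pow_le hk i (by omega)
    obtain ⟨j, hj⟩ := Nat.exists_eq_add_of_le hi
    obtain ⟨M, hM⟩ := Nat.exists_eq_add_of_le hk
    have e1 : N - i = (M + j) + 1 := by omega
    have e2 : k - i = j + 1 := by omega
    have e3 : N - (i + 1) = M + j := by omega
    have e4 : k - (i + 1) = j := by omega
    rw [e1, e2] at ih
    rw [e3, e4]
    have h := Nat.add_one_mul_choose_eq (M + j) j
    have h2 : (j + 1) * N ≤ k * (M + j + 1) := by subst hM; rw [hj]; nlinarith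
    have h3 : (M + j).choose j * N ≤ k * (M + j + 1).choose (j + 1) := by
      refine Nat.le_of_mul_le_mul_left (c := M + j + 1) ?_ (by omega)
      calc (M + j + 1) * ((M + j).choose j * N) = ((M + j + 1) * (M + j).choose j) * N := by ring
        _ = (M + j + 1).choose (j + 1) * ((j + 1) * N) := by rw [h]; ring
        _ ≤ (M + j + 1).choose (j + 1) * (k * (M + j + 1)) := Nat.mul_le_mul_left _ h2
        _ = (M + j + 1) * (k * (M + j + 1).choose (j + 1)) := by ring
    calc (M + j).choose j * N ^ (i + 1) = ((M + j).choose j * N) * N ^ i := by ring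
      _ ≤ (k * (M + j + 1).choose (j + 1)) * N ^ i := Nat.mul_le_mul_right _ h3
      _ = k * ((M + j + 1).choose (j + 1) * N ^ i) := by ring
      _ ≤ k * (k ^ i * N.choose k) := Nat.mul_le_mul_left _ ih
      _ = k ^ (i + 1) * N.choose k := by ring

/-- A random set of `k` vertices contains few collisions. -/
theorem sum_card_collisions_le {N k : ℕ} (hk : 4 ≤ k) (hkN : k ≤ N) :
    (∑ S ∈ Finset.powersetCard k (Finset.univ : Finset (Fin N)), (collisions S).card) * N ≤
      k ^ 4 * N.choose k := by
  classical
  have h1 : ∀ S : Finset (Fin N), (collisions S).card = ∑ x ∈ collisions Finset.univ,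
      if {x.1.1, x.1.2, x.2.1, x.2.2} ⊆ S then 1 else 0 := by
    intro S
    rw [← Finset.card_filter]
    congr 1
    ext x
    simp only [collisions, orderedPairs, Finset.mem_filter, Finset.mem_product,
      Finset.mem_univ, Finset.insert_subset_iff, Finset.singleton_subset_iff]
    tauto
  simp only [h1]
  rw [Finset.sum_comm]
  have h2 : ∀ x ∈ collisions (Finset.univ : Finset (Fin N)),
      (∑ S ∈ Finset.powersetCard k (Finset.univ : Finset (Fin N)),
        if {x.1.1, x.1.2, x.2.1, x.2.2} ⊆ S then 1 else 0) = (N - 4).choose (k - 4) := by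
    intro x hx
    -- Two different increasing pairs with the same sum share no vertex, so a collision involves
    -- four vertices and lies in `S` with probability at most `(k / N) ^ 4`.
    have hcard : ({x.1.1, x.1.2, x.2.1, x.2.2} : Finset (Fin N)).card = 4 := by
      obtain ⟨⟨a, b⟩, c, d⟩ := x
      simp only [collisions, orderedPairs, Finset.mem_filter, Finset.mem_product,
        Finset.mem_univ, pairSum, true_and, ne_eq, Prod.mk.injEq, Fin.lt_def, Fin.ext_iff] at hx
      rw [Finset.card_insert_of_notMem, Finset.card_insert_of_notMem, Finset.card_pair] <;>
        simp only [ne_eq, Finset.mem_insert, Finset.mem_singleton, Fin.ext_iff] <;> omega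
    rw [← Finset.card_filter, Finset.card_filter_powersetCard_subset _ _ _
      (Finset.subset_univ _) (by omega), hcard, Finset.card_univ, Fintype.card_fin]
  rw [Finset.sum_congr rfl h2, Finset.sum_const, smul_eq_mul]
  have h3 := card_collisions_univ_le N
  have h4 := choose_sub_mul_pow_le hkN 4 hk
  refine le_trans ?_ h4
  calc (collisions (Finset.univ : Finset (Fin N))).card * (N - 4).choose (k - 4) * N
      ≤ N ^ 3 * (N - 4).choose (k - 4) * N := by gcongr
    _ = _ := by ring

/-- The event that both edges of a pair of edges are present. -/
def doubleEdgeEvent {N : ℕ} (x : (Fin N × Fin N) × (Fin N × Fin N)) :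
    Set (SimpleGraph (Fin N)) := edgeEvent x.1 ∩ edgeEvent x.2

/-- Edges lost to repeated sums are charged to collisions both of whose edges are present. -/
theorem card_edgePairs_le {N : ℕ} (S : Finset (Fin N)) (G : SimpleGraph (Fin N)) :
    (edgePairs G S).card ≤ ((edgePairs G S).image pairSum).card +
      occurrences doubleEdgeEvent (collisions S) G := by
  classical
  refine (card_le_card_image_add (edgePairs G S) pairSum).trans (Nat.add_le_add_left ?_ _)
  refine Finset.card_le_card fun x hx => ?_
  obtain ⟨hx, hne⟩ := Finset.mem_filter.1 hx
  obtain ⟨h1, h2⟩ := Finset.mem_product.1 hx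
  have h1' := Finset.mem_filter.1 h1
  have h2' := Finset.mem_filter.1 h2
  exact Finset.mem_filter.2 ⟨Finset.mem_filter.2 ⟨Finset.mem_product.2 ⟨h1'.1, h2'.1⟩, hne⟩,
    h1'.2, h2'.2⟩

/-- Edges of a random graph on the vertex set `S` are likely to have many different sums. -/
theorem measureReal_image_pairSum_lt {N r : ℕ} (hr : 0 < r) (q : unitInterval)
    (S : Finset (Fin N)) (hq : 0 < (q : ℝ)) (hS : 4 * (r : ℝ) ≤ (orderedPairs S).card * q) :
    (SimpleGraph.binomialRandom (Fin N) q).real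
      {H | ((edgePairs H S).image pairSum).card < r} ≤
        1 / r + (collisions S).card * ((q : ℝ) ^ 2 / r) := by
  have hr' : (0 : ℝ) < r := by exact_mod_cast hr
  have hpos : 0 < (orderedPairs S).card := by
    by_contra h
    rw [Nat.eq_zero_of_not_pos h] at hS
    simp only [Nat.cast_zero, zero_mul] at hS
    linarith
  -- More than `2 * r` edges and fewer than `r` present collisions leave more than `r` sums.
  have hsub : {H : SimpleGraph (Fin N) | ((edgePairs H S).image pairSum).card < r} ⊆
      {H | (occurrences edgeEvent (orderedPairs S) H : ℝ) ≤ (orderedPairs S).card * q / 2} ∪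
        {H | r ≤ occurrences doubleEdgeEvent (collisions S) H} := by
    intro H hH
    by_contra hcon
    simp only [Set.mem_union, Set.mem_ofPred_eq, not_or, not_le] at hcon hH
    obtain ⟨h1, h2⟩ := hcon
    rw [occurrences_edgeEvent] at h1
    have h3 := card_edgePairs_le S H
    have h4 : 2 * r < (edgePairs H S).card := by
      have : (2 * r : ℝ) < (edgePairs H S).card := by linarith
      exact_mod_cast this
    omega
  refine (measureReal_mono hsub (measure_ne_top _ _)).trans
    ((measureReal_union_le _ _).trans (add_le_add ?_ ?_))
  · refine (measureReal_occurrences_le (measureReal_forall_edgeEvent q S) hq hpos).trans ?_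
    rw [div_le_div_iff₀ (by positivity) hr']
    linarith
  · rw [← mul_div_assoc]
    refine measureReal_le_occurrences_of_measureReal_eq _ _ (fun x hx => ?_) hr
    have hx := Finset.mem_filter.1 hx
    have h := Finset.mem_product.1 hx.1
    have := measureReal_forall_edgeEvent q S {x.1, x.2}
      (by simp [Finset.insert_subset_iff, h.1, h.2])
    rw [Finset.card_pair hx.2.1] at this
    rw [← this]
    congr 1
    ext G
    simp [doubleEdgeEvent]

theorem edgePairs_plant {N : ℕ} (S : Finset (Fin N)) (G H : SimpleGraph (Fin N)) :
    edgePairs (plant S G H) S = edgePairs H S := by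
  ext e
  rw [mem_edgePairs, mem_edgePairs]
  refine and_congr_right fun h => and_congr_right fun _ => ?_
  simp [plant, h.1, h.2]

/-- In a planted graph there is likely to be a set of `k` vertices that spans edges with many
different sums. -/
theorem le_plantedGraph {N k r : ℕ} (hk : 4 ≤ k) (hkN : k ≤ N) (hr : 0 < r) (p q : unitInterval)
    (hq : 0 < (q : ℝ)) (hkq : 16 * (r : ℝ) ≤ (k : ℝ) ^ 2 * q) :
    ENNReal.ofReal (1 - (1 / r + (k : ℝ) ^ 4 / N * ((q : ℝ) ^ 2 / r))) ≤
      plantedGraph N k p q {G | ∃ S : Finset (Fin N), S.card = k ∧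
        r ≤ ((edgePairs G S).image pairSum).card} := by
  set good : Set (SimpleGraph (Fin N)) := {G | ∃ S : Finset (Fin N), S.card = k ∧
        r ≤ ((edgePairs G S).image pairSum).card} with hgood
  set Q := SimpleGraph.binomialRandom (Fin N) q
  have hS : ∀ S ∈ Finset.powersetCard k (Finset.univ : Finset (Fin N)),
      ENNReal.ofReal (1 - (1 / r + (collisions S).card * ((q : ℝ) ^ 2 / r))) ≤
      ((SimpleGraph.binomialRandom (Fin N) p).prod Q).map (fun GH => plant S GH.1 GH.2) good := by
    intro S hS
    have hSk := (Finset.mem_powersetCard.1 hS).2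
    have hM : 4 * (r : ℝ) ≤ (orderedPairs S).card * q := by
      have h1 := two_mul_card_orderedPairs S
      rw [hSk] at h1
      have h2 : k * k ≤ 4 * (orderedPairs S).card := by
        have : 2 * k ≤ k * k := Nat.mul_le_mul_right k (by omega)
        omega
      have h3 : (k : ℝ) ^ 2 ≤ 4 * (orderedPairs S).card := by rw [sq]; exact_mod_cast h2
      nlinarith [mul_le_mul_of_nonneg_right h3 hq.le]
    have h1 := measureReal_image_pairSum_lt hr q S hq hM
    have h2 : Q.real {H | ((edgePairs H S).image pairSum).card < r}ᶜ =
        1 - Q.real {H | ((edgePairs H S).image pairSum).card < r} :=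
      probReal_compl_eq_one_sub (Set.toFinite _).measurableSet
    have h3 : ENNReal.ofReal (1 - (1 / r + (collisions S).card * ((q : ℝ) ^ 2 / r))) ≤
        Q {H | ((edgePairs H S).image pairSum).card < r}ᶜ := by
      rw [← ofReal_measureReal, h2]
      exact ENNReal.ofReal_le_ofReal (by linarith)
    refine h3.trans ?_
    rw [Measure.map_apply (measurable_of_finite _) (Set.toFinite _).measurableSet]
    -- Inside `S` the planted graph is `H`, so `G` is unrestricted.
    have h4 : (Set.univ ×ˢ {H : SimpleGraph (Fin N) | ((edgePairs H S).image pairSum).card < r}ᶜ) ⊆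
        (fun GH : SimpleGraph (Fin N) × SimpleGraph (Fin N) => plant S GH.1 GH.2) ⁻¹' good := by
      rintro ⟨G, H⟩ ⟨-, hH⟩
      refine ⟨S, hSk, ?_⟩
      rw [edgePairs_plant]
      exact not_lt.1 hH
    refine le_trans (le_of_eq ?_) (measure_mono h4)
    rw [Measure.prod_prod, measure_univ, one_mul]
  have hch : 0 < N.choose k := Nat.choose_pos hkN
  rw [plantedGraph, Measure.smul_apply, Measure.finsetSum_apply, smul_eq_mul]
  refine le_trans ?_ (mul_le_mul_right (Finset.sum_le_sum hS) _)
  set P := Finset.powersetCard k (Finset.univ : Finset (Fin N)) with hP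
  have hcard : P.card = N.choose k := by
    rw [hP, Finset.card_powersetCard, Finset.card_univ, Fintype.card_fin]
  -- For sets `S` with many collisions the lower bound may be negative. Subadditivity permits
  -- averaging before truncating, so only the mean number of collisions, at most `k ^ 4 / N`,
  -- matters.
  have hsum : ENNReal.ofReal (∑ S ∈ P, (1 - (1 / r + (collisions S).card * ((q : ℝ) ^ 2 / r)))) ≤
      ∑ S ∈ P, ENNReal.ofReal (1 - (1 / r + (collisions S).card * ((q : ℝ) ^ 2 / r))) :=
    Finset.le_sum_of_subadditive ENNReal.ofReal ENNReal.ofReal_zero.le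
      (fun _ _ => ENNReal.ofReal_add_le) P _
  refine le_trans ?_ (mul_le_mul_right hsum _)
  have hcoe : ((N.choose k : ENNReal))⁻¹ = ENNReal.ofReal ((N.choose k : ℝ)⁻¹) := by
    rw [ENNReal.ofReal_inv_of_pos (by exact_mod_cast hch), ENNReal.ofReal_natCast]
  rw [hcoe, ← ENNReal.ofReal_mul (by positivity)]
  refine ENNReal.ofReal_le_ofReal ?_
  have hch' : (0 : ℝ) < N.choose k := by exact_mod_cast hch
  have hN : (0 : ℝ) < N := by exact_mod_cast (by omega : 0 < N)
  have hcol : (∑ S ∈ P, ((collisions S).card : ℝ)) ≤ (k : ℝ) ^ 4 / N * N.choose k := by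
    have := sum_card_collisions_le hk hkN
    rw [div_mul_eq_mul_div, le_div_iff₀ hN]
    exact_mod_cast this
  rw [Finset.sum_sub_distrib, Finset.sum_add_distrib, Finset.sum_const, Finset.sum_const,
    ← Finset.sum_mul, hcard, nsmul_eq_mul, nsmul_eq_mul, inv_mul_eq_div, le_div_iff₀ hch']
  have := mul_le_mul_of_nonneg_right hcol (show 0 ≤ (q : ℝ) ^ 2 / r by positivity)
  nlinarith

/-! ### Choice of the parameters -/

/-- The exponent `α` of the conjecture. -/
noncomputable def alphaParam (h : ℕ) : ℝ := 1 / 3 + 1 / (6 * h)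

/-- The exponent `β` of the conjecture. -/
noncomputable def betaParam (h : ℕ) : ℝ := 1 / 3 + 1 / (12 * h)

theorem coe_powProb {N : ℕ} (hN : 0 < N) {a : ℝ} (ha : a ≤ 0) :
    (powProb N a : ℝ) = (N : ℝ) ^ a := by
  rw [powProb, Set.projIcc_of_mem]
  exact ⟨by positivity, Real.rpow_le_one_of_one_le_of_nonpos (by exact_mod_cast hN) ha⟩

theorem tendsto_natRoot {q : ℕ} (hq : q ≠ 0) : Tendsto (natRoot q) atTop atTop := by
  refine tendsto_atTop.2 fun B => (eventually_ge_atTop (B ^ q)).mono fun N hN => ?_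
  have h := (natRoot_spec hq N).2
  by_contra! hlt
  have := Nat.pow_le_pow_left (show natRoot q N + 1 ≤ B by omega) q
  omega

theorem tendsto_sqrt : Tendsto Nat.sqrt atTop atTop :=
  tendsto_atTop.2 fun B => (eventually_ge_atTop (B * B)).mono fun _ hN => Nat.le_sqrt.2 hN

section

variable {h N : ℕ}

theorem le_two_mul_natRoot_pow (hw : 1 ≤ natRoot (6 * h) N) (hh : 1 ≤ h) :
    N ≤ (2 * natRoot (6 * h) N) ^ (6 * h) :=
  ((natRoot_spec (by omega) N).2.trans_le (Nat.pow_le_pow_left (by omega) _)).le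

theorem coverTarget_eq (hh : 1 ≤ h) :
    coverTarget h N = natRoot (6 * h) N * vertexThreshold h N := by
  rw [coverTarget, vertexThreshold, ← pow_succ']
  congr 1
  omega

theorem coverTarget_le (hh : 1 ≤ h) : coverTarget h N ≤ N := by
  refine le_trans ?_ (natRoot_spec (show 6 * h ≠ 0 by omega) N).1
  rcases Nat.eq_zero_or_pos (natRoot (6 * h) N) with hw | hw
  · rw [coverTarget, hw, zero_pow (by omega)]; exact Nat.zero_le _
  · exact Nat.pow_le_pow_right hw (by omega)

theorem vertexThreshold_le (hh : 1 ≤ h) : vertexThreshold h N ≤ N := by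
  refine le_trans ?_ (natRoot_spec (show 6 * h ≠ 0 by omega) N).1
  rcases Nat.eq_zero_or_pos (natRoot (6 * h) N) with hw | hw
  · rw [vertexThreshold, hw, zero_pow (by omega)]; exact Nat.zero_le _
  · exact Nat.pow_le_pow_right hw (by omega)

/-- The target is at most `N ^ (2 / 3)`, and `N ≤ 4 * k ^ 2` for `k = ⌊√N⌋`. -/
theorem coverTarget_rpow_le (hh : 1 ≤ h) (hk : 1 ≤ N.sqrt) :
    (coverTarget h N : ℝ) ≤ 4 * (N.sqrt : ℝ) ^ (4 / 3 : ℝ) := by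
  have hh' : (0 : ℝ) < h := by exact_mod_cast hh
  have h1 : (coverTarget h N : ℝ) ≤ (N : ℝ) ^ (2 / 3 : ℝ) := by
    have h2 : ((natRoot (6 * h) N : ℝ)) ^ (6 * h) ≤ N := by
      exact_mod_cast (natRoot_spec (show 6 * h ≠ 0 by omega) N).1
    refine le_trans (le_of_eq ?_) (Real.rpow_le_rpow (by positivity) h2 (by norm_num))
    rw [← Real.rpow_natCast, ← Real.rpow_mul (by positivity), coverTarget]
    push_cast
    rw [← Real.rpow_natCast]
    congr 1
    push_cast
    ring
  have h3 : (N : ℝ) ≤ 4 * (N.sqrt : ℝ) ^ 2 := by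
    have : N < (N.sqrt + 1) * (N.sqrt + 1) := Nat.lt_succ_sqrt N
    have : N ≤ 4 * N.sqrt ^ 2 := by nlinarith
    exact_mod_cast this
  refine h1.trans ((Real.rpow_le_rpow (by positivity) h3 (by norm_num)).trans ?_)
  rw [Real.mul_rpow (by norm_num) (by positivity), ← Real.rpow_natCast, ← Real.rpow_mul
    (by positivity)]
  refine mul_le_mul ?_ (le_of_eq (by norm_num)) (by positivity) (by norm_num)
  calc (4 : ℝ) ^ (2 / 3 : ℝ) ≤ 4 ^ (1 : ℝ) :=
        Real.rpow_le_rpow_of_exponent_le (by norm_num) (by norm_num)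
    _ = 4 := Real.rpow_one 4

theorem betaParam_le (hh : 1 ≤ h) : betaParam h ≤ 5 / 12 := by
  have hh' : (1 : ℝ) ≤ h := by exact_mod_cast hh
  have : 1 / (12 * (h : ℝ)) ≤ 1 / 12 := by
    apply one_div_le_one_div_of_le <;> linarith
  rw [betaParam]
  linarith

theorem alphaParam_le (hh : 1 ≤ h) : alphaParam h ≤ 1 / 2 := by
  have hh' : (1 : ℝ) ≤ h := by exact_mod_cast hh
  have : 1 / (6 * (h : ℝ)) ≤ 1 / 6 := by
    apply one_div_le_one_div_of_le <;> linarith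
  rw [alphaParam]
  linarith

/-- With `q = k ^ (β - 1)` one has `k ^ 2 * q = k ^ (4/3 + 1/(12h))`; the spare power `k ^
(1/(12h))` absorbs the constant `64 = 16 * 4`. -/
theorem coverTarget_le_sq_mul (hh : 1 ≤ h) (hk : 1 ≤ N.sqrt)
    (hk' : (64 : ℝ) ≤ (N.sqrt : ℝ) ^ (1 / (12 * h) : ℝ)) :
    16 * (coverTarget h N : ℝ) ≤ (N.sqrt : ℝ) ^ 2 * powProb N.sqrt (betaParam h - 1) := by
  have hk0 : (0 : ℝ) < N.sqrt := by exact_mod_cast hk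
  have hb := betaParam_le hh
  rw [coe_powProb hk (by linarith), ← Real.rpow_natCast, ← Real.rpow_add hk0]
  have : ((2 : ℕ) : ℝ) + (betaParam h - 1) = 4 / 3 + 1 / (12 * h) := by
    rw [betaParam]; push_cast; ring
  rw [this, Real.rpow_add hk0]
  have h1 := coverTarget_rpow_le hh hk
  have h2 : 0 < (N.sqrt : ℝ) ^ (4 / 3 : ℝ) := by positivity
  nlinarith

/-- Since `2 * β ≤ 1` and `k ^ 2 ≤ N`, the expected number of present collisions is at most `(k * q)
^ 2 ≤ k`. The largeness of `w` gives `16 * k ≤ w ^ (3h + 1) ≤ r`, so each of the two errors is at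
most `1/16`. -/
theorem planted_error_le (hh : 1 ≤ h) (hk : 1 ≤ N.sqrt)
    (hw : 16 * 2 ^ (3 * h) ≤ natRoot (6 * h) N) :
    1 / (coverTarget h N : ℝ) + (N.sqrt : ℝ) ^ 4 / N *
      ((powProb N.sqrt (betaParam h - 1) : ℝ) ^ 2 / coverTarget h N) ≤ 1 / 8 := by
  set w := natRoot (6 * h) N with hw'
  set k := N.sqrt with hk'
  have hk0 : (0 : ℝ) < k := by exact_mod_cast hk
  have h2h : 1 ≤ 2 ^ (3 * h) := Nat.one_le_two_pow
  have hkN : k ^ 2 ≤ N := by rw [sq]; exact Nat.sqrt_le N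
  have hN0 : (0 : ℝ) < N := by
    have : 0 < k ^ 2 := by positivity
    exact_mod_cast this.trans_le hkN
  have hkw : k ≤ (2 * w) ^ (3 * h) := by
    have h1 : k ^ 2 ≤ (2 * w) ^ (6 * h) := hkN.trans (le_two_mul_natRoot_pow (by omega) hh)
    rw [show (2 * w) ^ (6 * h) = ((2 * w) ^ (3 * h)) ^ 2 by rw [← pow_mul]; congr 1; ring] at h1
    exact (Nat.pow_le_pow_iff_left two_ne_zero).1 h1
  have hrk : 16 * k ≤ coverTarget h N := by
    calc 16 * k ≤ 16 * (2 * w) ^ (3 * h) := Nat.mul_le_mul_left _ hkw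
      _ = (16 * 2 ^ (3 * h)) * w ^ (3 * h) := by rw [mul_pow]; ring
      _ ≤ w * w ^ (3 * h) := Nat.mul_le_mul_right _ hw
      _ = w ^ (3 * h + 1) := by rw [pow_succ']
      _ ≤ w ^ (4 * h) := Nat.pow_le_pow_right (by omega) (by omega)
  have hrk' : 16 * (k : ℝ) ≤ coverTarget h N := by exact_mod_cast hrk
  set r := coverTarget h N
  have hk1 : (1 : ℝ) ≤ k := by exact_mod_cast hk
  have hr0 : (0 : ℝ) < r := by linarith
  have hb := betaParam_le hh
  set q : ℝ := (powProb k (betaParam h - 1) : ℝ) with hq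
  have hq0 : 0 ≤ q := (powProb k (betaParam h - 1)).2.1
  have hkq : (k * q) ^ 2 ≤ k := by
    have h1 : k * q = (k : ℝ) ^ betaParam h := by
      rw [hq, coe_powProb hk (by linarith)]
      conv_lhs => rw [← Real.rpow_one (k : ℝ)]
      rw [Real.rpow_one, ← Real.rpow_one_add' (by positivity)]
      · congr 1; ring
      · have : 0 < betaParam h := by rw [betaParam]; positivity
        linarith
    rw [h1, ← Real.rpow_natCast, ← Real.rpow_mul hk0.le]
    refine (Real.rpow_le_rpow_of_exponent_le hk1 (y := betaParam h * (2 : ℕ)) (z := 1) ?_).trans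
      (Real.rpow_one _).le
    push_cast
    linarith
  have hkN' : (k : ℝ) ^ 2 ≤ N := by exact_mod_cast hkN
  have h1 : (k : ℝ) ^ 4 / N * (q ^ 2 / r) ≤ 1 / 16 := by
    rw [div_mul_div_comm, div_le_div_iff₀ (by positivity) (by norm_num)]
    calc (k : ℝ) ^ 4 * q ^ 2 * 16 = k ^ 2 * ((k * q) ^ 2 * 16) := by ring
      _ ≤ (N : ℝ) * r := mul_le_mul hkN' (by linarith) (by positivity) hN0.le
      _ = 1 * ((N : ℝ) * r) := (one_mul _).symm
  have h2 : 1 / (r : ℝ) ≤ 1 / 16 := one_div_le_one_div_of_le (by norm_num) (by linarith)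
  linarith

/-- The choice of `α` gives `p ≤ (w ^ (6h)) ^ (α - 1) = 1 / V`, hence `(1 + p) ^ V ≤ e < 4`. As the
target is `w * V`, the whole bound is the `V`-th power of at most `4 * N / 2 ^ w`, and `32 * N ≤ 2 ^
w`. -/
theorem null_error_le (hh : 1 ≤ h) (hw : 1 ≤ natRoot (6 * h) N)
    (hw' : 32 * (2 * natRoot (6 * h) N) ^ (6 * h) ≤ 2 ^ natRoot (6 * h) N) :
    (N : ℝ) ^ vertexThreshold h N * ((1 + powProb N (alphaParam h - 1)) ^ vertexThreshold h N ^ 2 /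
      2 ^ coverTarget h N) ≤ 1 / 8 := by
  have hNw := le_two_mul_natRoot_pow hw hh
  have hwN := (natRoot_spec (show 6 * h ≠ 0 by omega) N).1
  rw [coverTarget_eq hh]
  set w := natRoot (6 * h) N with hwdef
  set V := vertexThreshold h N with hV
  have hw0 : (0 : ℝ) < w := by exact_mod_cast hw
  have hV1 : 1 ≤ V := Nat.one_le_pow _ _ hw
  have hV0 : (0 : ℝ) < V := by exact_mod_cast hV1
  have hN0 : 0 < N := (Nat.pow_pos hw).trans_le hwN
  have hα := alphaParam_le hh
  have hh' : (0 : ℝ) < h := by exact_mod_cast hh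
  have hp : (powProb N (alphaParam h - 1) : ℝ) ≤ 1 / V := by
    rw [coe_powProb hN0 (by linarith)]
    have h1 : ((w : ℝ) ^ (6 * h)) ≤ N := by exact_mod_cast hwN
    refine (Real.rpow_le_rpow_of_nonpos (by positivity) h1 (by linarith)).trans (le_of_eq ?_)
    rw [← Real.rpow_natCast, ← Real.rpow_mul hw0.le, hV, vertexThreshold, ← hwdef, Nat.cast_pow,
      ← Real.rpow_natCast, one_div, ← Real.rpow_neg hw0.le]
    congr 1
    rw [Nat.cast_sub (by omega), alphaParam]
    push_cast
    field_simp
    ring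
  set p : ℝ := (powProb N (alphaParam h - 1) : ℝ)
  have hp0 : 0 ≤ p := (powProb N (alphaParam h - 1)).2.1
  have hexp : (1 + p) ^ V ≤ 4 := by
    calc (1 + p) ^ V ≤ (Real.exp p) ^ V := by
          gcongr
          rw [add_comm]
          exact Real.add_one_le_exp p
      _ = Real.exp (V * p) := by rw [← Real.exp_nat_mul]
      _ ≤ Real.exp 1 := by
          rw [Real.exp_le_exp, mul_comm]
          rwa [le_div_iff₀ hV0] at hp
      _ ≤ 4 := by have := Real.exp_one_lt_d9; linarith
  have hN32 : 32 * (N : ℝ) ≤ 2 ^ w := by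
    have : 32 * N ≤ 2 ^ w := (Nat.mul_le_mul_left _ hNw).trans hw'
    exact_mod_cast this
  have h2w : (0 : ℝ) < 2 ^ w := by positivity
  calc (N : ℝ) ^ V * ((1 + p) ^ V ^ 2 / 2 ^ (w * V)) = (N * ((1 + p) ^ V) / 2 ^ w) ^ V := by
        rw [div_pow, mul_pow, ← pow_mul, ← pow_mul, sq, mul_div_assoc]
    _ ≤ (1 / 8) ^ V := by
        refine pow_le_pow_left₀ (by positivity) ?_ _
        rw [div_le_div_iff₀ h2w (by norm_num)]
        have : (N : ℝ) * (1 + p) ^ V ≤ N * 4 := by gcongr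
        linarith
    _ ≤ 1 / 8 := pow_le_of_le_one (by norm_num) (by norm_num) (by omega)

/-- The factor `N ^ (1/6 - ε) * k` is at most `N ^ (2/3 - 1/(3h)) ≤ (2 * w) ^ (4h - 2)`, whereas `V
= w ^ (4h - 1)`. The one extra factor `w` beats all constants. -/
theorem ratio_lt {C ε : ℝ} (hh : 1 ≤ h) (hε : 1 / (3 * h) ≤ ε) (hC : 0 ≤ C)
    (hw : 1 ≤ natRoot (6 * h) N) (hw' : 2 * C * 2 ^ (4 * h - 2) < natRoot (6 * h) N) :
    C * (N : ℝ) ^ (1 / 6 - ε) * (2 * (N.sqrt * N)) < N * vertexThreshold h N := by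
  have hNw := le_two_mul_natRoot_pow hw hh
  have hwN := (natRoot_spec (show 6 * h ≠ 0 by omega) N).1
  rw [vertexThreshold]
  set w := natRoot (6 * h) N with hwdef
  have hw0 : (0 : ℝ) < w := by exact_mod_cast hw
  have hN1 : 1 ≤ N := (Nat.one_le_pow _ _ hw).trans hwN
  have hN0 : (0 : ℝ) < N := by exact_mod_cast hN1
  have hN1' : (1 : ℝ) ≤ N := by exact_mod_cast hN1
  have hh' : (1 : ℝ) ≤ h := by exact_mod_cast hh
  have hk : (N.sqrt : ℝ) ≤ (N : ℝ) ^ (1 / 2 : ℝ) := by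
    rw [← Real.sqrt_eq_rpow]
    exact Real.nat_sqrt_le_real_sqrt
  have he : 0 ≤ 2 / 3 - 1 / (3 * (h : ℝ)) := by
    have : 1 / (3 * (h : ℝ)) ≤ 1 / 3 := one_div_le_one_div_of_le (by norm_num) (by linarith)
    linarith
  have h1 : (N : ℝ) ^ (1 / 6 - ε) * N.sqrt ≤ 2 ^ (4 * h - 2) * (w : ℝ) ^ (4 * h - 2) := by
    calc (N : ℝ) ^ (1 / 6 - ε) * N.sqrt ≤ (N : ℝ) ^ (1 / 6 - ε) * (N : ℝ) ^ (1 / 2 : ℝ) := by gcongr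
      _ = (N : ℝ) ^ (1 / 6 - ε + 1 / 2) := (Real.rpow_add hN0 _ _).symm
      _ ≤ (N : ℝ) ^ (2 / 3 - 1 / (3 * (h : ℝ))) :=
          Real.rpow_le_rpow_of_exponent_le hN1' (by linarith)
      _ ≤ (((2 * w) ^ (6 * h) : ℕ) : ℝ) ^ (2 / 3 - 1 / (3 * (h : ℝ))) :=
          Real.rpow_le_rpow hN0.le (by exact_mod_cast hNw) he
      _ = 2 ^ (4 * h - 2) * (w : ℝ) ^ (4 * h - 2) := by
          push_cast
          rw [← mul_pow, ← Real.rpow_natCast, ← Real.rpow_mul (by positivity),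
            ← Real.rpow_natCast]
          congr 1
          rw [Nat.cast_sub (by omega)]
          push_cast
          field_simp
          ring
  have hpow : (w : ℝ) ^ (4 * h - 1) = w * (w : ℝ) ^ (4 * h - 2) := by
    rw [← pow_succ']; congr 1; omega
  push_cast
  calc C * (N : ℝ) ^ (1 / 6 - ε) * (2 * (N.sqrt * N))
      = N * (2 * C * ((N : ℝ) ^ (1 / 6 - ε) * N.sqrt)) := by ring
    _ ≤ N * (2 * C * (2 ^ (4 * h - 2) * (w : ℝ) ^ (4 * h - 2))) := by gcongr
    _ = N * ((2 * C * 2 ^ (4 * h - 2)) * (w : ℝ) ^ (4 * h - 2)) := by ring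
    _ < N * (w * (w : ℝ) ^ (4 * h - 2)) := by gcongr
    _ = N * (w : ℝ) ^ (4 * h - 1) := by rw [hpow]

end

/-! ### The distinguisher -/

theorem mul_measure_le_lintegral {Ω : Type*} [Finite Ω] [MeasurableSpace Ω]
    [MeasurableSingletonClass Ω] (μ : Measure Ω) (f : Ω → ENNReal) (A : Set Ω) (a : ENNReal)
    (h : ∀ ω ∈ A, a ≤ f ω) : a * μ A ≤ ∫⁻ ω, f ω ∂μ := by
  rw [← lintegral_indicator_const (Set.toFinite A).measurableSet]
  refine lintegral_mono fun ω => ?_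
  by_cases hω : ω ∈ A
  · rw [Set.indicator_of_mem hω]; exact h ω hω
  · rw [Set.indicator_of_notMem hω]; exact zero_le

/-- In either case the answer is correct with probability at least `2/3 * 7/8 = 7/12 = 1/2 + 1/12`.
-/
theorem le_pdsSuccess {α β : ℝ} {k N : ℕ} {c : Prog} (A B : Set (SimpleGraph (Fin N)))
    (hA : ∀ G ∈ A, 2 / 3 ≤ outputProb c (encodeGraph G) {Data.nil})
    (hB : ∀ G ∈ B, 2 / 3 ≤ outputProb c (encodeGraph G) {Data.nil}ᶜ)
    (hA' : ENNReal.ofReal (7 / 8) ≤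
      SimpleGraph.binomialRandom (Fin N) (powProb N (α - 1)) A)
    (hB' : ENNReal.ofReal (7 / 8) ≤ plantedGraph N k (powProb N (α - 1)) (powProb k (β - 1)) B) :
    1 / 2 + ENNReal.ofReal (1 / 12) ≤ pdsSuccess α β k N c := by
  have h1 := (mul_le_mul_right hA' (2 / 3)).trans (mul_measure_le_lintegral _ _ A _ hA)
  have h2 := (mul_le_mul_right hB' (2 / 3)).trans (mul_measure_le_lintegral _ _ B _ hB)
  refine le_trans (le_of_eq ?_) (add_le_add (mul_le_mul_right h1 (1 / 2))
    (mul_le_mul_right h2 (1 / 2)))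
  have e1 : (1 / 2 : ENNReal) = ENNReal.ofReal (1 / 2) := by
    rw [ENNReal.ofReal_div_of_pos (by norm_num)]; simp
  have e2 : (2 / 3 : ENNReal) = ENNReal.ofReal (2 / 3) := by
    rw [ENNReal.ofReal_div_of_pos (by norm_num)]; simp
  rw [e1, e2, ← ENNReal.ofReal_add (by norm_num) (by norm_num),
    ← ENNReal.ofReal_mul (by norm_num), ← ENNReal.ofReal_mul (by norm_num),
    ← ENNReal.ofReal_add (by norm_num) (by norm_num)]
  norm_num

/-- A good approximation algorithm contradicts the conjecture. -/
theorem PDSConjecture.not_isApproxAlgorithm (hPDS : PDSConjecture) {c : Prog} {ρ : Instance → ℝ}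
    {C ε : ℝ} (hε : 0 < ε) (hC : 0 ≤ C)
    (hρ : ∀ h, 1 ≤ h → ∀ᶠ N : ℕ in atTop, ∀ G : SimpleGraph (Fin N),
      ρ (graphInstance h G) ≤ C * (N : ℝ) ^ (1 / 6 - ε)) : ¬ IsApproxAlgorithm c ρ := by
  intro hc
  -- The loss `1/(3h)` in the exponent has to be at most `ε`.
  obtain ⟨h₀, hh₀⟩ := exists_nat_gt (1 / (3 * ε))
  set h := h₀ + 1
  have hh : 1 ≤ h := by omega
  have hh' : (0 : ℝ) < h := by exact_mod_cast hh
  have hhε : 1 / (3 * (h : ℝ)) ≤ ε := by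
    have h1 : 1 / (3 * ε) ≤ h := hh₀.le.trans (by push_cast [h]; linarith)
    rw [div_le_iff₀ (by positivity)] at h1 ⊢
    linarith
  obtain ⟨c', hc', hout⟩ := exists_prog_threshold hc.1 h
  have hα := alphaParam_le hh
  refine hPDS (alphaParam h) (betaParam h) (by rw [betaParam]; positivity) ?_ (by linarith)
    ⟨c', 1 / 12, hc', by norm_num, ?_⟩
  · rw [alphaParam, betaParam]
    gcongr
    norm_num
  have hq : 6 * h ≠ 0 := by omega
  have ev1 := (tendsto_natRoot hq).eventually (eventually_ge_atTop (16 * 2 ^ (3 * h)))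
  have ev2 := (tendsto_natRoot hq).eventually
    ((tendsto_natCast_atTop_atTop (R := ℝ)).eventually_gt_atTop (2 * C * 2 ^ (4 * h - 2)))
  -- In terms of `w`, the number of vertices is polynomial, so `2 ^ w` eventually dominates.
  have ev3 : ∀ᶠ w : ℕ in atTop, 32 * (2 * w) ^ (6 * h) ≤ 2 ^ w := by
    have h1 : (fun w : ℕ => (w : ℝ) ^ (6 * h)) =o[atTop] fun w : ℕ => (2 : ℝ) ^ w :=
      isLittleO_pow_const_const_pow_of_one_lt (6 * h) (by norm_num)
    filter_upwards [h1.bound (show (0 : ℝ) < 1 / (32 * 2 ^ (6 * h)) by positivity)] with w hw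
    rw [Real.norm_of_nonneg (by positivity), Real.norm_of_nonneg (by positivity), one_div,
      inv_mul_eq_div, le_div_iff₀ (by positivity)] at hw
    have : 32 * (2 * (w : ℝ)) ^ (6 * h) ≤ 2 ^ w := by rw [mul_pow]; linarith
    exact_mod_cast this
  have ev4 := (tendsto_natRoot hq).eventually ev3
  have ev5 := tendsto_sqrt.eventually (((tendsto_rpow_atTop
    (show (0 : ℝ) < 1 / (12 * h) by positivity)).comp
      (tendsto_natCast_atTop_atTop (R := ℝ))).eventually_ge_atTop 64)
  have ev6 := tendsto_sqrt.eventually (eventually_ge_atTop 4)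
  filter_upwards [ev1, ev2, ev4, ev5, ev6, hρ h hh, eventually_gt_atTop 0] with N h1 h2 h3 h4 h5 h6
    hN
  simp only [Function.comp_apply] at h4
  have hw : 1 ≤ natRoot (6 * h) N := le_trans (by have := Nat.one_le_two_pow (n := 3 * h); omega) h1
  have hk : 1 ≤ N.sqrt := by omega
  have hkN : N.sqrt ≤ N := Nat.sqrt_le_self N
  have hr : 0 < coverTarget h N := Nat.pow_pos hw
  have happrox : ∀ G : SimpleGraph (Fin N), 2 / 3 ≤ outputProb c (graphInstance h G).encode
      {d | ∃ C, d = (graphInstance h G).encodeFamily C ∧ (graphInstance h G).IsSolution C ∧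
        (C.card : ℝ) ≤ ρ (graphInstance h G) * (graphInstance h G).opt} :=
    fun G => hc.2 _ (pcscInstance_feasible hN _)
  refine le_pdsSuccess {G | ∃ U : Finset (Fin N), U.card ≤ vertexThreshold h N ∧
      coverTarget h N ≤ (edgePairs G U).card}ᶜ
    {G | ∃ S : Finset (Fin N), S.card = N.sqrt ∧
      coverTarget h N ≤ ((edgePairs G S).image pairSum).card} ?_ ?_ ?_ ?_
  · intro G hG
    refine (happrox G).trans ((hout G _).1 fun D hD => ?_)
    refine le_card_of_isSolution (vertexThreshold_le hh) (fun U hU => ?_) hD.1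
    exact lt_of_not_ge fun hcon => hG ⟨U, hU, hcon⟩
  · rintro G ⟨S, hS, hSr⟩
    refine (happrox G).trans ((hout G _).2 fun D hD => ?_)
    obtain ⟨D', hD', hcard⟩ := exists_isSolution hr hSr
    have hopt : (graphInstance h G).opt ≤ 2 * (N.sqrt * N) := by
      refine (Nat.sInf_le (show D'.card ∈ {k | ∃ C, (graphInstance h G).IsSolution C ∧ C.card = k}
        from ⟨D', hD', rfl⟩)).trans (hcard.trans ?_)
      rw [hS]
      have := Nat.mul_le_mul_left N.sqrt hkN
      omega
    have hopt' : ((graphInstance h G).opt : ℝ) ≤ 2 * (N.sqrt * N) := by exact_mod_cast hopt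
    have : (D.card : ℝ) < N * vertexThreshold h N := by
      refine (hD.2.trans ?_).trans_lt (ratio_lt hh hhε hC hw h2)
      exact mul_le_mul (h6 G) hopt' (Nat.cast_nonneg _) (by positivity)
    exact_mod_cast this
  · have e1 := (measureReal_exists_edgePairs_le (vertexThreshold_le hh)
      -- `r` edges on few vertices are more than `G(N, p)` supports, whatever the sums: distinctness
      -- matters only in the planted case.
      (powProb N (alphaParam h - 1)) (coverTarget h N)).trans (null_error_le hh hw h3)
    rw [← ofReal_measureReal, probReal_compl_eq_one_sub (Set.toFinite _).measurableSet]
    exact ENNReal.ofReal_le_ofReal (by linarith)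
  · have hq0 : 0 < (powProb N.sqrt (betaParam h - 1) : ℝ) := by
      have := betaParam_le hh
      rw [coe_powProb hk (by linarith)]
      have : (0 : ℝ) < N.sqrt := by exact_mod_cast hk
      positivity
    refine le_trans (ENNReal.ofReal_le_ofReal ?_) (le_plantedGraph h5 hkN hr
      (powProb N (alphaParam h - 1)) (powProb N.sqrt (betaParam h - 1)) hq0
      (coverTarget_le_sq_mul hh hk h4))
    have := planted_error_le hh hk h1
    linarith

end PrecCover

/-! ### The ratios in terms of the number of sets and of items -/

theorem mainTheorem10 (hPDS : PrecCover.PDSConjecture) (ε : ℝ) (hε : 0 < ε) :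
    (¬ ∃ (ρ : ℕ → ℝ) (c : PrecCover.Prog),
        ρ =O[atTop] (fun m : ℕ => (m : ℝ) ^ (1 / 12 - ε : ℝ)) ∧
        PrecCover.IsApproxAlgorithm c (fun I => ρ I.m)) ∧
    (¬ ∃ (ρ : ℕ → ℝ) (c : PrecCover.Prog),
        ρ =O[atTop] (fun n : ℕ => (n : ℝ) ^ (1 / 6 - ε : ℝ)) ∧
        PrecCover.IsApproxAlgorithm c (fun I => ρ I.n)) := by
  constructor
  · rintro ⟨ρ, c, hρ, hc⟩
    obtain ⟨K, hK, hρ⟩ := hρ.exists_pos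
    -- As `m = 2 * N ^ 2`, the power `m ^ (1/12 - ε)` equals `2 ^ (1/12 - ε) * N ^ (1/6 - 2 * ε)`.
    refine hPDS.not_isApproxAlgorithm (ε := 2 * ε) (C := K * 2 ^ (1 / 12 - ε)) (by linarith)
      (by positivity) (fun h hh => ?_) hc
    have hm : Tendsto (fun N : ℕ => 2 * (N * N)) atTop atTop :=
      tendsto_atTop_mono (fun N => by have := Nat.le_mul_self N; rw [id]; omega) tendsto_id
    filter_upwards [hm.eventually hρ.bound] with N hN G
    have hm' : (PrecCover.graphInstance h G).m = 2 * (N * N) := PrecCover.length_labels N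
    rw [hm']
    refine (le_abs_self _).trans (hN.trans (le_of_eq ?_))
    have hN0 : (0 : ℝ) ≤ N := Nat.cast_nonneg N
    rw [Real.norm_of_nonneg (by positivity), mul_assoc]
    push_cast
    rw [Real.mul_rpow (by norm_num) (by positivity), ← sq, ← Real.rpow_natCast,
      ← Real.rpow_mul hN0]
    congr 3
    push_cast
    ring
  · rintro ⟨ρ, c, hρ, hc⟩
    obtain ⟨K, hK, hρ⟩ := hρ.exists_pos
    refine hPDS.not_isApproxAlgorithm (ε := ε) (C := K * 6) hε
      (by positivity) (fun h hh => ?_) hc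
    have hn : Tendsto (fun N : ℕ => 4 * N + 2 * PrecCover.coverTarget h N) atTop atTop :=
      tendsto_atTop_mono (fun N => by rw [id]; omega) tendsto_id
    filter_upwards [hn.eventually hρ.bound, eventually_gt_atTop 0] with N hN hN0 G
    have hn' : (PrecCover.graphInstance h G).n = 4 * N + 2 * PrecCover.coverTarget h N := rfl
    rw [hn']
    set n := 4 * N + 2 * PrecCover.coverTarget h N
    refine (le_abs_self _).trans (hN.trans ?_)
    have hN0' : (0 : ℝ) < N := by exact_mod_cast hN0
    rw [Real.norm_of_nonneg (by positivity), mul_assoc]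
    have hle : n ≤ 6 * N := by
      have := PrecCover.coverTarget_le hh (N := N)
      omega
    have hle' : (n : ℝ) ≤ 6 * N := by exact_mod_cast hle
    have hge : (N : ℝ) ≤ n := by exact_mod_cast (by omega : N ≤ n)
    refine mul_le_mul_of_nonneg_left ?_ hK.le
    -- The exponent may be negative for large `ε`. According to its sign, `n ≤ 6 * N` or `N ≤ n` is
    -- used.
    rcases le_total 0 (1 / 6 - ε) with he | he
    · refine (Real.rpow_le_rpow (by positivity) hle' he).trans ?_
      rw [Real.mul_rpow (by norm_num) hN0'.le]
      gcongr
      calc (6 : ℝ) ^ (1 / 6 - ε) ≤ 6 ^ (1 : ℝ) :=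
            Real.rpow_le_rpow_of_exponent_le (by norm_num) (by linarith)
        _ = 6 := Real.rpow_one 6
    · refine (Real.rpow_le_rpow_of_nonpos hN0' hge he).trans ?_
      have : 0 ≤ (N : ℝ) ^ (1 / 6 - ε) := by positivity
      linarith
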